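/- For a tournament $T$ and an integer $\ell\ge 3$, let $t(C_\ell,T)$ be the number of homomorphisms from the directed cycle $C_\ell$ of length $\ell$ to $T$, divided by $|V(T)|^\ell$. For an integer $\ell\ge 4$ define $g_\ell:[0,1/8]\to[0,1]$ by $g_\ell(0)=0$ and, for every real $z\in(0,1]$, $$g_\ell\left(\frac18\Big(\lfloor z^{-1}\rfloor z^3+(1-\lfloor z^{-1}\rfloor z)^3\Big)\right)=\frac1{2^\ell}\Big(\lfloor z^{-1}\rfloor z^\ell+(1-\lfloor z^{-1}\rfloor z)^\ell\Big);$$ this is well defined, because $z\mapsto \lfloor z^{-1}\rfloor z^3+(1-\lfloor z^{-1}\rfloor z)^3$ is a bijection of $(0,1]$ onto itself. Let $\ell\ge 4$ be an integer with $\ell\not\equiv 2\pmod 4$. Then every tournament $T$ with $t(C_3,T)\ge \frac18-\frac1{10\ell^2}$ satisfies $$t(C_\ell,T)\ \ge\ g_\ell(t(C_3,T))+o(1),$$ where the $o(1)$ term goes to zero as $|V(T)|\to\infty$; that is, for every $\varepsilon>0$ there is $N=N(\ell,\varepsilon)$ such that $t(C_\ell,T)\ge g_\ell(t(C_3,T))-\varepsilon$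 for all such $T$ with at least $N$ vertices. Moreover, the bound is asymptotically tight: for every $s\in[\frac18-\frac1{10\ell^2},\frac18]$ and every $\varepsilon>0$ there is $N$ such that for every $n\ge N$ there is a tournament $T$ on $n$ vertices with $t(C_3,T)\ge\frac18-\frac1{10\ell^2}$, $|t(C_3,T)-s|\le\varepsilon$ and $t(C_\ell,T)\le g_\ell(t(C_3,T))+\varepsilon$. -/

import Mathlib

/-- A digraph is a tournament if it has no loops and any two distinct vertices are joined by an arc
in exactly one of the two directions. -/
structure IsTournament {V : Type*} (T : Digraph V) : Prop where
  loopless : ∀ v, ¬ T.Adj v v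
  oriented : ∀ u v, u ≠ v → Xor (T.Adj u v) (T.Adj v u)

/-- The directed cycle with vertex set `ℤ/ℓ` and arcs `i → i + 1`. -/
def directedCycle (ℓ : ℕ) : Digraph (ZMod ℓ) where
  Adj i j := j = i + 1

/-- The density `t(C_ℓ, T)`: the number of arc-preserving maps from the directed cycle of length `ℓ`
to `T`, divided by `|V(T)| ^ ℓ`. -/
noncomputable def cycleDensity (ℓ : ℕ) {V : Type*} (T : Digraph V) : ℝ :=
  (Nat.card ((directedCycle ℓ).Adj →r T.Adj) : ℝ) / (Nat.card V : ℝ) ^ ℓ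

/-- The sum of the `p`-th powers of the part sizes when an interval of length one is cut into
`⌊1/z⌋` parts of size `z` and one part containing the (smaller) rest. -/
noncomputable def partPowerSum (p : ℕ) (z : ℝ) : ℝ :=
  (⌊z⁻¹⌋₊ : ℝ) * z ^ p + (1 - (⌊z⁻¹⌋₊ : ℝ) * z) ^ p

open Classical in
/-- The function `g_ℓ` on `[0, 1/8]`: it is `0` at `0`, and at `partPowerSum 3 z / 8`, where
`z ∈ (0, 1]`, it is `partPowerSum ℓ z / 2 ^ ℓ` (see `blowUpDensity_apply`, which also shows that
the choice of `z` does not matter). The value outside `[0, 1/8]` is irrelevant. -/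
noncomputable def blowUpDensity (ℓ : ℕ) (s : ℝ) : ℝ :=
  if h : ∃ z ∈ Set.Ioc (0 : ℝ) 1, s = (1 / 8) * partPowerSum 3 z then
    (1 / 2 ^ ℓ) * partPowerSum ℓ h.choose
  else 0

theorem cube_split_lt (m z w : ℝ) (hm : 0 < m) (hz : 0 < z) (hzw : z < w)
    (h1 : 1 - m * z ≤ z) (h2 : m * w ≤ 1) :
    m * z ^ 3 + (1 - m * z) ^ 3 < m * w ^ 3 + (1 - m * w) ^ 3 := by
  have hb0 : 0 ≤ 1 - m * w := by linarith
  have hmz : m * z < m * w := mul_lt_mul_of_pos_left hzw hm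
  have ha0 : 0 ≤ 1 - m * z := by linarith
  have hbw : 1 - m * w < w := by linarith
  have e1 : (1 - m * z) ^ 2 ≤ z ^ 2 := pow_le_pow_left₀ ha0 h1 2
  have e2 : (1 - m * w) ^ 2 < w ^ 2 := pow_lt_pow_left₀ hbw hb0 (by norm_num)
  have e3 : (1 - m * z) * (1 - m * w) ≤ z * w := mul_le_mul h1 hbw.le hb0 hz.le
  have key : 0 < m * (w - z) * ((w ^ 2 + z * w + z ^ 2)
      - ((1 - m * z) ^ 2 + (1 - m * z) * (1 - m * w) + (1 - m * w) ^ 2)) := by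
    apply mul_pos (mul_pos hm (by linarith))
    linarith
  nlinarith [key]

theorem partPowerSum_three_strictMonoOn :
    StrictMonoOn (partPowerSum 3) (Set.Ioc (0 : ℝ) 1) := by
  intro z hz w hw hzw
  obtain ⟨hz0, hz1⟩ := hz
  obtain ⟨hw0, hw1⟩ := hw
  have mpos : ∀ x : ℝ, 0 < x → x ≤ 1 → (1 : ℝ) ≤ (⌊x⁻¹⌋₊ : ℝ) := by
    intro x h0 h1
    have : 1 ≤ ⌊x⁻¹⌋₊ := Nat.le_floor (by simpa using (one_le_inv₀ h0).2 h1)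
    exact_mod_cast this
  have low : ∀ x : ℝ, 0 < x → (⌊x⁻¹⌋₊ : ℝ) * x ≤ 1 := by
    intro x h0
    have h := Nat.floor_le (inv_nonneg.2 h0.le)
    calc (⌊x⁻¹⌋₊ : ℝ) * x ≤ x⁻¹ * x := mul_le_mul_of_nonneg_right h h0.le
      _ = 1 := inv_mul_cancel₀ h0.ne'
  have high : ∀ x : ℝ, 0 < x → 1 < ((⌊x⁻¹⌋₊ : ℝ) + 1) * x := by
    intro x h0
    have h := Nat.lt_floor_add_one x⁻¹
    calc 1 = x⁻¹ * x := (inv_mul_cancel₀ h0.ne').symm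
      _ < _ := mul_lt_mul_of_pos_right h h0
  have hle : ⌊w⁻¹⌋₊ ≤ ⌊z⁻¹⌋₊ := Nat.floor_le_floor (inv_anti₀ hz0 hzw.le)
  have lz := low z hz0
  have lw := low w hw0
  have uz := high z hz0
  have uw := high w hw0
  have mw := mpos w hw0 hw1
  unfold partPowerSum
  rcases hle.eq_or_lt with heq | hlt
  · rw [← heq] at uz ⊢
    exact cube_split_lt _ z w (by linarith) hz0 hzw (by linarith) lw
  · have hlt' : (⌊w⁻¹⌋₊ : ℝ) + 1 ≤ (⌊z⁻¹⌋₊ : ℝ) := by exact_mod_cast hlt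
    generalize (⌊w⁻¹⌋₊ : ℝ) = m at *
    generalize (⌊z⁻¹⌋₊ : ℝ) = k at *
    have hm1 : 0 < m + 1 := by linarith
    have hu0 : 0 < (m + 1)⁻¹ := inv_pos.2 hm1
    have hmu : m * (m + 1)⁻¹ = 1 - (m + 1)⁻¹ := by field_simp; ring
    have huw : (m + 1)⁻¹ < w := by
      rw [inv_lt_iff_one_lt_mul₀ hm1]; linarith
    have hzu : z ≤ (m + 1)⁻¹ := by
      rw [le_inv_comm₀ hz0 hm1, ← one_div, le_div_iff₀ hz0]
      nlinarith
    have h := cube_split_lt m (m + 1)⁻¹ w (by linarith) hu0 huw (by linarith) lw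
    have hu : m * (m + 1)⁻¹ ^ 3 + (1 - m * (m + 1)⁻¹) ^ 3 = (m + 1)⁻¹ ^ 2 := by
      field_simp; ring
    have hz2 : k * z ^ 3 + (1 - k * z) ^ 3 ≤ z ^ 2 := by
      have a0 : 0 ≤ 1 - k * z := by linarith
      have a1 : 1 - k * z ≤ z := by linarith
      have a2 : (1 - k * z) ^ 2 ≤ z ^ 2 := pow_le_pow_left₀ a0 a1 2
      nlinarith [mul_le_mul_of_nonneg_left a2 a0]
    have : z ^ 2 ≤ (m + 1)⁻¹ ^ 2 := pow_le_pow_left₀ hz0.le hzu 2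
    linarith

theorem blowUpDensity_apply (ℓ : ℕ) {z : ℝ} (hz : z ∈ Set.Ioc (0 : ℝ) 1) :
    blowUpDensity ℓ ((1 / 8) * partPowerSum 3 z) = (1 / 2 ^ ℓ) * partPowerSum ℓ z := by
  have h : ∃ y ∈ Set.Ioc (0 : ℝ) 1,
      (1 / 8) * partPowerSum 3 z = (1 / 8) * partPowerSum 3 y := ⟨z, hz, rfl⟩
  have e : h.choose = z := by
    apply partPowerSum_three_strictMonoOn.injOn h.choose_spec.1 hz
    linarith [h.choose_spec.2]
  rw [blowUpDensity, dif_pos h, e]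

theorem blowUpDensity_zero (ℓ : ℕ) : blowUpDensity ℓ 0 = 0 := by
  rw [blowUpDensity, dif_neg]
  rintro ⟨z, ⟨h0, h1⟩, h⟩
  have a : 1 ≤ ⌊z⁻¹⌋₊ := Nat.le_floor (by simpa using (one_le_inv₀ h0).2 h1)
  have a' : (1 : ℝ) ≤ (⌊z⁻¹⌋₊ : ℝ) := by exact_mod_cast a
  have b : (⌊z⁻¹⌋₊ : ℝ) * z ≤ 1 := by
    calc (⌊z⁻¹⌋₊ : ℝ) * z ≤ z⁻¹ * z :=
          mul_le_mul_of_nonneg_right (Nat.floor_le (inv_nonneg.2 h0.le)) h0.le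
      _ = 1 := inv_mul_cancel₀ h0.ne'
  have c : 0 < (⌊z⁻¹⌋₊ : ℝ) * z ^ 3 := by positivity
  have d : 0 ≤ (1 - (⌊z⁻¹⌋₊ : ℝ) * z) ^ 3 := pow_nonneg (by linarith) 3
  unfold partPowerSum at h
  linarith

/-! Lower bound. Let `A` be the adjacency matrix of `T` on `n` vertices and `N = (2/n)(A + 1/2)`.
Then `2^k t(C_k,T)` is the trace of `N^k` up to `O(1/n)`, so it is essentially the `k`-th power sum
of the spectrum of `N`. This spectrum is closed under conjugation and sums to one. Since `N + Nᵀ` is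
`2/n` times the all-ones matrix, its real parts are nonnegative; the imaginary parts satisfy `b² ≤
1/2` (`eigenvalue_bounds`).

Choose `z > 1/2` with `z³ + (1-z)³ = 8 t(C_3,T)`; the hypothesis forces `1 - z ≤ 3/(10ℓ²)`. A large
third power sum yields a real eigenvalue `x > 1/2`, and the real parts of the others sum to `1 - x`.
As `Re (a+bi)³ = a³ - 3ab²`, the third power sum of the others falls short of `(1-x)³` by `3B + D`,
where `B` is the sum of the `ab²` and `D` is the loss from splitting `1 - x` into several parts. The
cubic condition then becomes `B + D/3 ≤ (x-z)(x+z-1)`: any such loss must be paid for by `x`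
exceeding `z`. In the `ℓ`-th power sum, enlarging `z` to `x` gains at least `(9/10)ℓ(x-z)`, which
exceeds the losses: at most `(9/10)ℓB` from imaginary parts (`re_pow_ge_of_le`, where `ℓ ≢ 2 mod 4`
is essential) and a small multiple of `ℓD` from splitting. This is
`powerSum_ge_of_powerSum_three_ge`.

Tightness. Compressing a skew Hadamard matrix gives a tournament for which `N` is a rank-one
projection plus an error of norm `O(n^(-1/2))`, so its cycle densities tend to `2^(-k)` for `k ≥ 3`.
Two of these, with vertex proportions `z` and `1 - z` and all cross arcs in one direction, realise
the bound in the limit. -/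

set_option linter.unusedSectionVars false

/-! ### Power sums of eigenvalues -/

section PowerSums

open Polynomial

variable {n : Type*} [Fintype n] [DecidableEq n]

/-- Both sides are multiplicative in `p`, and over `ℂ` every polynomial is a product of a constant
and factors `X - a`, so only these two kinds need checking. -/
theorem Matrix.det_aeval_eq_prod_roots_charpoly (A : Matrix n n ℂ) (p : ℂ[X]) :
    (aeval A p).det = (A.charpoly.roots.map fun μ => p.eval μ).prod := by
  let φ : ℂ[X] →* ℂ := Matrix.detMonoidHom.comp (aeval A : ℂ[X] →ₐ[ℂ] Matrix n n ℂ).toMonoidHom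
  let ψ : ℂ[X] →* ℂ :=
    { toFun := fun p => (A.charpoly.roots.map fun μ => p.eval μ).prod
      map_one' := by simp
      map_mul' := by intro p q; simp [Multiset.prod_map_mul] }
  have hcard : A.charpoly.roots.card = Fintype.card n := by
    rw [(splits_iff_card_roots.1 (IsAlgClosed.splits A.charpoly)), A.charpoly_natDegree_eq_dim]
  have hC : ∀ c : ℂ, φ (C c) = ψ (C c) := by
    intro c
    simp [φ, ψ, hcard, Matrix.algebraMap_eq_diagonal, Matrix.det_diagonal]
  have hX : ∀ a : ℂ, φ (X - C a) = ψ (X - C a) := by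
    intro a
    have h1 : φ (X - C a) = (-1) ^ Fintype.card n * A.charpoly.eval a := by
      rw [Matrix.eval_charpoly, ← Matrix.det_neg]
      simp [φ, Matrix.algebraMap_eq_diagonal, Matrix.scalar_apply, Pi.algebraMap_def]
    have h2 : A.charpoly.eval a = (A.charpoly.roots.map fun μ => a - μ).prod := by
      conv_lhs => rw [(IsAlgClosed.splits A.charpoly).eq_prod_roots_of_monic A.charpoly_monic]
      rw [eval_multiset_prod, Multiset.map_map]
      simp
    rw [h1, h2, ← hcard, ← Multiset.card_map (fun μ => a - μ), ← Multiset.prod_map_neg,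
      Multiset.map_map]
    simp [ψ]
  change φ p = ψ p
  rw [(IsAlgClosed.splits p).eq_prod_roots, map_mul, map_mul, hC, map_multiset_prod,
    map_multiset_prod, Multiset.map_map, Multiset.map_map]
  congr 2
  exact Multiset.map_congr rfl fun a _ => hX a

/-- Taking `p = t - X^k` in the determinant formula for every `t` identifies the roots of the
characteristic polynomial of `A^k`, with multiplicity. -/
theorem Matrix.trace_pow_eq_sum_roots_charpoly (A : Matrix n n ℂ) (k : ℕ) :
    (A ^ k).trace = (A.charpoly.roots.map (· ^ k)).sum := by
  have h : (A ^ k).charpoly = ((A.charpoly.roots.map (· ^ k)).map fun μ => X - C μ).prod := by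
    apply Polynomial.funext
    intro t
    have h1 := A.det_aeval_eq_prod_roots_charpoly (C t - X ^ k)
    rw [Matrix.eval_charpoly, eval_multiset_prod, Multiset.map_map, Multiset.map_map]
    simpa [Matrix.algebraMap_eq_diagonal, Matrix.scalar_apply, Pi.algebraMap_def] using h1
  rw [Matrix.trace_eq_sum_roots_charpoly, h, roots_multiset_prod_X_sub_C]

theorem Matrix.star_mem_roots_charpoly (A : Matrix n n ℝ) {μ : ℂ}
    (h : μ ∈ (A.map (algebraMap ℝ ℂ)).charpoly.roots) :
    star μ ∈ (A.map (algebraMap ℝ ℂ)).charpoly.roots := by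
  rw [mem_roots (Matrix.charpoly_monic _).ne_zero, IsRoot] at h ⊢
  rw [Matrix.charpoly_map] at h ⊢
  rw [eval_map] at h ⊢
  have := congrArg star h
  rw [star_zero, eval₂_eq_sum_range, star_sum] at this
  rw [eval₂_eq_sum_range, ← this]
  refine Finset.sum_congr rfl fun i _ => ?_
  simp

end PowerSums

/-! ### Homomorphisms from directed cycles as traces -/

section CycleCount

open Matrix

variable {V : Type*} [Fintype V] [DecidableEq V]

/-- The free closing factor `B` makes the induction go through; `B = A` gives closed walks. -/
theorem Matrix.trace_pow_mul_eq_sum_paths {R : Type*} [CommRing R] (A : Matrix V V R) (m : ℕ) :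
    ∀ B : Matrix V V R, (A ^ m * B).trace =
      ∑ f : Fin (m + 1) → V, (∏ i : Fin m, A (f i.castSucc) (f i.succ)) * B (f (Fin.last m)) (f 0) := by
  induction m with
  | zero =>
    intro B
    rw [← (Equiv.funUnique (Fin 1) V).symm.sum_comp]
    simp [Matrix.trace]
  | succ m ih =>
    intro B
    rw [pow_succ, Matrix.mul_assoc, ih]
    rw [← (Fin.snocEquiv fun _ : Fin (m + 2) => V).sum_comp, Fintype.sum_prod_type,
      Finset.sum_comm]
    refine Finset.sum_congr rfl fun f _ => ?_
    rw [Matrix.mul_apply, Finset.mul_sum]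
    refine Finset.sum_congr rfl fun v _ => ?_
    have h0 : Fin.snoc (α := fun _ => V) f v 0 = f 0 := by
      rw [← Fin.castSucc_zero, Fin.snoc_castSucc]
    simp only [Fin.snocEquiv_apply, Fin.snoc_last, h0]
    rw [Fin.prod_univ_castSucc]
    simp only [Fin.snoc_castSucc, ← Fin.castSucc_succ, Fin.succ_last, Fin.snoc_last]
    ring

open Classical in
/-- The adjacency matrix of a digraph. -/
noncomputable def Digraph.realAdjMatrix (T : Digraph V) : Matrix V V ℝ :=
  Matrix.of fun u v => if T.Adj u v then 1 else 0

theorem card_cycleHom_eq_trace (T : Digraph V) {ℓ : ℕ} (hℓ : 0 < ℓ) :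
    (Nat.card ((directedCycle ℓ).Adj →r T.Adj) : ℝ) = (T.realAdjMatrix ^ ℓ).trace := by
  classical
  obtain ⟨m, rfl⟩ : ∃ m, ℓ = m + 1 := ⟨ℓ - 1, by omega⟩
  have e : ((directedCycle (m + 1)).Adj →r T.Adj) ≃
      {f : Fin (m + 1) → V // ∀ i, T.Adj (f i) (f (i + 1))} :=
    { toFun := fun φ => ⟨fun i => φ i, fun i =>
        φ.map_rel (show (directedCycle (m + 1)).Adj (i : Fin (m + 1)) (i + 1 : Fin (m + 1)) from rfl)⟩
      invFun := fun f => ⟨fun i => f.1 i, by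
        rintro a b (rfl : b = a + 1)
        exact f.2 a⟩
      left_inv := fun _ => rfl
      right_inv := fun _ => rfl }
  rw [Nat.card_congr e, Nat.card_eq_fintype_card, Fintype.card_subtype, pow_succ,
    Matrix.trace_pow_mul_eq_sum_paths, Finset.card_filter, Nat.cast_sum]
  refine Finset.sum_congr rfl fun f _ => ?_
  have h : (∏ i : Fin m, T.realAdjMatrix (f i.castSucc) (f i.succ)) *
      T.realAdjMatrix (f (Fin.last m)) (f 0) =
      ∏ i : Fin (m + 1), T.realAdjMatrix (f i) (f (i + 1)) := by
    rw [Fin.prod_univ_castSucc]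
    simp
  rw [h]
  simp only [Digraph.realAdjMatrix, Matrix.of_apply]
  by_cases hf : ∀ i, T.Adj (f i) (f (i + 1))
  · simp [hf]
  · rw [if_neg hf]
    push Not at hf
    obtain ⟨i, hi⟩ := hf
    rw [Finset.prod_eq_zero (Finset.mem_univ i) (by simp [hi])]
    simp

theorem cycleDensity_eq_trace (T : Digraph V) {ℓ : ℕ} (hℓ : 0 < ℓ) :
    cycleDensity ℓ T = (T.realAdjMatrix ^ ℓ).trace / (Fintype.card V : ℝ) ^ ℓ := by
  rw [cycleDensity, card_cycleHom_eq_trace T hℓ, Nat.card_eq_fintype_card]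

end CycleCount

/-! ### Real parts of powers of complex numbers near the imaginary axis -/

section PowerEstimates

/-- The value is `b^ℓ` if `4 ∣ ℓ` and `0` if `ℓ` is odd. At residue 2 it would be `-b^ℓ`; this is
where the congruence condition enters. -/
theorem re_I_mul_pow_nonneg {ℓ : ℕ} (hmod : ¬ ℓ ≡ 2 [MOD 4]) {b : ℝ} :
    0 ≤ (((b : ℂ) * Complex.I) ^ ℓ).re := by
  rw [mul_pow, ← Complex.ofReal_pow, Complex.re_ofReal_mul, ← Nat.div_add_mod ℓ 4, pow_add Complex.I,
    pow_mul Complex.I, Complex.I_pow_four, one_pow, one_mul]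
  have h4 : ℓ % 4 < 4 := Nat.mod_lt _ (by norm_num)
  have h2 : ℓ % 4 ≠ 2 := hmod
  have hcases : ℓ % 4 = 0 ∨ ℓ % 4 = 1 ∨ ℓ % 4 = 3 := by omega
  rcases hcases with h | h | h <;> rw [h]
  · have : Even (4 * (ℓ / 4) + 0) := ⟨2 * (ℓ / 4), by ring⟩
    simpa using this.pow_nonneg b
  · simp
  · simp [pow_succ]

theorem norm_add_pow_sub_pow_le (u v : ℂ) {r : ℝ} (hv : ‖v‖ ≤ r) (huv : ‖u + v‖ ≤ r) (ℓ : ℕ) :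
    ‖(u + v) ^ (ℓ + 1) - v ^ (ℓ + 1)‖ ≤ (ℓ + 1) * ‖u‖ * r ^ ℓ := by
  have hr : 0 ≤ r := (norm_nonneg _).trans hv
  induction ℓ with
  | zero => simp
  | succ k ih =>
    have e : (u + v) ^ (k + 1 + 1) - v ^ (k + 1 + 1) =
        (u + v) * ((u + v) ^ (k + 1) - v ^ (k + 1)) + u * v ^ (k + 1) := by ring
    rw [e]
    calc _ ≤ ‖u + v‖ * ‖(u + v) ^ (k + 1) - v ^ (k + 1)‖ + ‖u‖ * ‖v‖ ^ (k + 1) := by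
          refine (norm_add_le _ _).trans ?_
          rw [norm_mul, norm_mul, norm_pow]
      _ ≤ r * ((k + 1) * ‖u‖ * r ^ k) + ‖u‖ * r ^ (k + 1) := by gcongr
      _ = _ := by push_cast; ring

theorem norm_add_pow_sub_taylor_le (u v : ℂ) {r : ℝ} (hu : ‖u‖ ≤ r) (huv : ‖u + v‖ ≤ r) (ℓ : ℕ) :
    ‖(u + v) ^ (ℓ + 2) - u ^ (ℓ + 2) - (ℓ + 2) * u ^ (ℓ + 1) * v‖ ≤
      (ℓ + 2) * (ℓ + 1) / 2 * ‖v‖ ^ 2 * r ^ ℓ := by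
  have hr : 0 ≤ r := (norm_nonneg _).trans hu
  induction ℓ with
  | zero =>
    have e : (u + v) ^ (0 + 2) - u ^ (0 + 2) - (((0 : ℕ) : ℂ) + 2) * u ^ (0 + 1) * v = v ^ 2 := by
      push_cast; ring
    rw [e, norm_pow]; simp
  | succ k ih =>
    have e : (u + v) ^ (k + 1 + 2) - u ^ (k + 1 + 2) -
        (((k + 1 : ℕ) : ℂ) + 2) * u ^ (k + 1 + 1) * v =
        (u + v) * ((u + v) ^ (k + 2) - u ^ (k + 2) - (k + 2) * u ^ (k + 1) * v) +
          ((k + 2 : ℕ) : ℂ) * (u ^ (k + 1) * v ^ 2) := by push_cast; ring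
    rw [e]
    calc _ ≤ ‖u + v‖ * ‖(u + v) ^ (k + 2) - u ^ (k + 2) - (k + 2) * u ^ (k + 1) * v‖ +
            (k + 2 : ℕ) * (‖u‖ ^ (k + 1) * ‖v‖ ^ 2) := by
          refine (norm_add_le _ _).trans ?_
          rw [norm_mul, norm_mul, norm_mul, norm_pow, norm_pow, Complex.norm_natCast]
      _ ≤ r * ((k + 2) * (k + 1) / 2 * ‖v‖ ^ 2 * r ^ k) + (k + 2 : ℕ) * (r ^ (k + 1) * ‖v‖ ^ 2) := by
          gcongr
      _ = _ := by push_cast; ring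

/-- The cost of an imaginary part is measured in units of `ab²`, the quantity lost in `Re μ³`. The
factor `9/10` is what the gain in `pow_add_pow_gain` can pay for. -/
theorem re_pow_ge_of_le {ℓ : ℕ} (hℓ : 4 ≤ ℓ) (hmod : ¬ ℓ ≡ 2 [MOD 4]) {μ : ℂ}
    (ha : 0 ≤ μ.re) (ha' : μ.re ≤ 3 / (10 * (ℓ : ℝ) ^ 2)) (hb : μ.im ^ 2 ≤ 1 / 2) :
    μ.re ^ ℓ - 9 / 10 * ℓ * (μ.re * μ.im ^ 2) ≤ (μ ^ ℓ).re := by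
  set a := μ.re with hadef
  set b := μ.im with hbdef
  set r := ‖μ‖ with hrdef
  have hr0 : 0 ≤ r := norm_nonneg _
  have hr2 : r ^ 2 = a ^ 2 + b ^ 2 := by
    rw [hrdef, Complex.sq_norm, Complex.normSq_apply]; ring
  have hL : (4 : ℝ) ≤ ℓ := by exact_mod_cast hℓ
  have hL2 : (16 : ℝ) ≤ (ℓ : ℝ) ^ 2 := by nlinarith
  have ha1 : a * (ℓ : ℝ) ^ 2 ≤ 3 / 10 := by
    rw [le_div_iff₀ (by positivity)] at ha'; linarith
  have ha2 : a ≤ 3 / 160 := by nlinarith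
  have hμ : (a : ℂ) + b * Complex.I = μ := Complex.re_add_im μ
  have har : a ≤ r := (le_abs_self _).trans (Complex.abs_re_le_norm μ)
  have hbr : |b| ≤ r := Complex.abs_im_le_norm μ
  -- Near the imaginary axis `μ^ℓ` is compared with `(bi)^ℓ`, whose real part is nonnegative;
  -- otherwise it is compared with `a^ℓ`.
  by_cases hab : 9 * a ^ 2 ≤ b ^ 2
  · obtain ⟨m, rfl⟩ : ∃ m, ℓ = m + 3 + 1 := ⟨ℓ - 4, by omega⟩
    have h := norm_add_pow_sub_pow_le (a : ℂ) (b * Complex.I) (r := r) (by simpa using hbr)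
      (by rw [hμ]) (m + 3)
    rw [hμ] at h
    have h1 := (abs_le.1 ((Complex.abs_re_le_norm _).trans h)).1
    have h2 := re_I_mul_pow_nonneg hmod (b := b)
    rw [Complex.sub_re, Complex.norm_real, Real.norm_of_nonneg ha] at h1
    have hr1 : r ≤ 3 / 4 := by nlinarith
    have hrm : r ^ m ≤ 1 := pow_le_one₀ hr0 (by linarith)
    have ham : a ^ m ≤ 1 := pow_le_one₀ ha (by linarith)
    have hrr : r ^ (m + 3) ≤ 5 / 6 * b ^ 2 := by
      calc r ^ (m + 3) = r ^ m * (r * r ^ 2) := by ring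
        _ ≤ 1 * (3 / 4 * r ^ 2) := by gcongr
        _ ≤ 5 / 6 * b ^ 2 := by nlinarith
    have haa : a ^ (m + 3 + 1) ≤ a * (1 / 100 * b ^ 2) := by
      calc a ^ (m + 3 + 1) = a * (a ^ m * (a * a ^ 2)) := by ring
        _ ≤ a * (1 * (3 / 160 * a ^ 2)) := by gcongr
        _ ≤ a * (1 / 100 * b ^ 2) := by gcongr a * ?_; nlinarith
    push_cast at h1 hL ⊢
    have h3 : ((m : ℝ) + 3 + 1) * a * r ^ (m + 3) ≤ ((m : ℝ) + 3 + 1) * a * (5 / 6 * b ^ 2) := by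
      gcongr
    have h4 : 0 ≤ a * b ^ 2 := by positivity
    nlinarith
  · push Not at hab
    obtain ⟨m, rfl⟩ : ∃ m, ℓ = m + 2 + 2 := ⟨ℓ - 4, by omega⟩
    -- The first-order term in `bi` is purely imaginary, so only the second-order remainder affects
    -- the real part.
    have h := norm_add_pow_sub_taylor_le (a : ℂ) (b * Complex.I) (r := r)
      (by simpa [abs_of_nonneg ha] using har) (by rw [hμ]) (m + 2)
    rw [hμ] at h
    have h1 := (abs_le.1 ((Complex.abs_re_le_norm _).trans h)).1
    have e0 : ((((m + 2 : ℕ) : ℂ) + 2) * (a : ℂ) ^ (m + 2 + 1) * (b * Complex.I)).re = 0 := by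
      have : (((m + 2 : ℕ) : ℂ) + 2) * (a : ℂ) ^ (m + 2 + 1) * (b * Complex.I) =
        (((((m + 2 : ℕ) : ℝ) + 2) * a ^ (m + 2 + 1) * b : ℝ) : ℂ) * Complex.I := by
        push_cast; ring
      rw [this, Complex.re_ofReal_mul]; simp
    have e1 : ((a : ℂ) ^ (m + 2 + 2)).re = a ^ (m + 2 + 2) := by
      rw [← Complex.ofReal_pow, Complex.ofReal_re]
    rw [Complex.sub_re, Complex.sub_re, e0, e1] at h1
    have e2 : ‖(b : ℂ) * Complex.I‖ ^ 2 = b ^ 2 := by simp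
    rw [e2] at h1
    have hra : r ≤ 16 / 5 * a := by
      refine le_of_sq_le_sq ?_ (by positivity)
      nlinarith
    have hrm : r ^ m ≤ 1 := pow_le_one₀ hr0 (by linarith)
    push_cast at h1 hL ha1 ⊢
    set L : ℝ := (m : ℝ) + 2 + 2
    have hL1 : ((m : ℝ) + 2 + 1) = L - 1 := by simp only [L]; ring
    rw [hL1] at h1
    have hrr : (L - 1) / 2 * r ^ (m + 2) ≤ 9 / 10 * a := by
      calc (L - 1) / 2 * r ^ (m + 2) = (L - 1) / 2 * (r ^ m * (r * r)) := by ring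
        _ ≤ (L - 1) / 2 * (1 * (16 / 5 * a * (16 / 5 * a))) := by gcongr; linarith
        _ = (128 / 25 * ((L - 1) * a)) * a := by ring
        _ ≤ 9 / 10 * a := by gcongr ?_ * a; nlinarith
    have h3 : L * b ^ 2 * ((L - 1) / 2 * r ^ (m + 2)) ≤ L * b ^ 2 * (9 / 10 * a) := by gcongr
    nlinarith

end PowerEstimates

/-! ### The inequality for the power sums of a spectrum -/

section SpectralInequality

/-- Raising the exponent by one adds `p^(k+2) (1-p)` to `1 - p^(k+2)`, and this is at most `p(1-p) ≤
(1-p²)/2`. -/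
theorem pow_sub_pow_le_of_mem_Icc {p : ℝ} (h0 : 0 ≤ p) (h1 : p ≤ 1) (m : ℕ) :
    p - p ^ (m + 3) ≤ (m + 2) / 2 * (p - p ^ 3) := by
  have key : 1 - p ^ (m + 2) ≤ (m + 2) / 2 * (1 - p ^ 2) := by
    induction m with
    | zero => simp
    | succ k ih =>
      have : p ^ (k + 2) * (1 - p) ≤ 1 / 2 * (1 - p ^ 2) := by
        have : p ^ (k + 2) ≤ p ^ 1 := pow_le_pow_of_le_one h0 h1 (by omega)
        nlinarith
      push_cast
      rw [pow_succ p (k + 2)] at *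
      nlinarith [pow_succ p (k + 2)]
  nlinarith [mul_le_mul_of_nonneg_left key h0, pow_succ p (m + 2)]

theorem tangent_le_pow {u v : ℝ} (hu : 0 ≤ u) (hv : 0 ≤ v) (ℓ : ℕ) :
    v ^ (ℓ + 1) + (ℓ + 1) * v ^ ℓ * (u - v) ≤ u ^ (ℓ + 1) := by
  induction ℓ with
  | zero => simp
  | succ k ih =>
    have h1 := mul_le_mul_of_nonneg_left ih hu
    have h2 : 0 ≤ (k + 1) * v ^ k * (u - v) ^ 2 := by positivity
    push_cast
    have e : v ^ (k + 1 + 1) + (k + 1 + 1) * v ^ (k + 1) * (u - v) =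
      u * (v ^ (k + 1) + (k + 1) * v ^ k * (u - v)) - (k + 1) * v ^ k * (u - v) ^ 2 := by ring
    rw [e, pow_succ' u (k + 1)]; linarith

theorem Multiset.sum_map_nonneg_of_mem {α : Type*} (m : Multiset α) (f : α → ℝ)
    (h : ∀ x ∈ m, 0 ≤ f x) : 0 ≤ (m.map f).sum :=
  Multiset.sum_nonneg (by simpa using h)

theorem Multiset.le_sum_map_of_mem {α : Type*} {m : Multiset α} {f : α → ℝ}
    (h : ∀ x ∈ m, 0 ≤ f x) {x : α} (hx : x ∈ m) : f x ≤ (m.map f).sum :=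
  Multiset.single_le_sum (by simpa using h) _ (Multiset.mem_map_of_mem f hx)

/-- Rescaling by `y` reduces this to the scalar inequality for each `μ.re / y ∈ [0,1]`. The
splitting loss at a higher power is thus controlled by the loss at the cube, with a small factor
`y^k`. -/
theorem Multiset.pow_sum_sub_sum_pow_le (m : Multiset ℂ) (h : ∀ μ ∈ m, 0 ≤ μ.re) {y : ℝ}
    (hy : (m.map Complex.re).sum = y) (k : ℕ) :
    y ^ (k + 3) - (m.map fun μ => μ.re ^ (k + 3)).sum ≤
      y ^ k * ((k + 2) / 2) * (y ^ 3 - (m.map fun μ => μ.re ^ 3).sum) := by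
  have hy0 : 0 ≤ y := hy ▸ m.sum_map_nonneg_of_mem _ h
  have hterm : ∀ μ ∈ m, μ.re * y ^ (k + 2) - μ.re ^ (k + 3) ≤
      y ^ k * ((k + 2) / 2) * (μ.re * y ^ 2 - μ.re ^ 3) := by
    intro μ hμ
    have ha := h μ hμ
    have hay : μ.re ≤ y := hy ▸ Multiset.le_sum_map_of_mem h hμ
    rcases hy0.eq_or_lt with h0 | h0
    · have : μ.re = 0 := le_antisymm (h0 ▸ hay) ha
      simp [this]
    · have := pow_sub_pow_le_of_mem_Icc (div_nonneg ha hy0) ((div_le_one h0).2 hay) k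
      have h2 := mul_le_mul_of_nonneg_left this (pow_nonneg hy0 (k + 3))
      have e1 : y ^ (k + 3) * (μ.re / y - (μ.re / y) ^ (k + 3)) =
          μ.re * y ^ (k + 2) - μ.re ^ (k + 3) := by
        rw [mul_sub, ← mul_pow, mul_div_cancel₀ _ h0.ne', pow_succ y (k + 2)]
        field_simp
      have e2 : y ^ (k + 3) * ((k + 2) / 2 * (μ.re / y - (μ.re / y) ^ 3)) =
          y ^ k * ((k + 2) / 2) * (μ.re * y ^ 2 - μ.re ^ 3) := by
        rw [pow_add]; field_simp
      rw [e1, e2] at h2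
      exact h2
  have := Multiset.sum_map_le_sum_map _ _ hterm
  rw [Multiset.sum_map_sub, Multiset.sum_map_mul_right, Multiset.sum_map_mul_left,
    Multiset.sum_map_sub, Multiset.sum_map_mul_right] at this
  have hre : (m.map fun μ => μ.re).sum = y := hy
  rw [hre] at this
  calc _ = y * y ^ (k + 2) - (m.map fun μ => μ.re ^ (k + 3)).sum := by ring
    _ ≤ _ := this
    _ = _ := by ring

theorem Complex.re_pow_three (μ : ℂ) : (μ ^ 3).re = μ.re ^ 3 - 3 * (μ.re * μ.im ^ 2) := by
  simp [pow_succ]; ring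

/-- A conjugation-invariant multiset in the right half-plane with sum one and large third power sum
contains a real number exceeding one half. -/
theorem exists_real_mem_of_powerSum_three {m : Multiset ℂ} (hre : ∀ μ ∈ m, 0 ≤ μ.re)
    (hstar : ∀ μ ∈ m, star μ ∈ m) (hsum : (m.map Complex.re).sum = 1)
    (h3 : 3 / 4 ≤ (m.map fun μ => (μ ^ 3).re).sum) :
    ∃ x : ℝ, 1 / 2 < x ∧ (x : ℂ) ∈ m := by
  -- Otherwise `Re μ³ ≤ a³ ≤ a/4` for every member, and the third power sum is at most `1/4`.
  have hex : ∃ μ ∈ m, 1 / 2 < μ.re := by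
    by_contra! hcon
    have hle : ∀ μ ∈ m, (μ ^ 3).re ≤ μ.re * (1 / 4) := by
      intro μ hμ
      rw [Complex.re_pow_three]
      have h0 := hre μ hμ
      have h1 := hcon μ hμ
      have : μ.re ^ 2 ≤ 1 / 4 := by nlinarith
      nlinarith [mul_nonneg h0 (sq_nonneg μ.im), mul_le_mul_of_nonneg_left this h0]
    have := Multiset.sum_map_le_sum_map _ _ hle
    rw [Multiset.sum_map_mul_right, show (m.map fun μ => μ.re).sum = 1 from hsum] at this
    linarith
  obtain ⟨μ, hμ, hμ2⟩ := hex
  -- A nonreal member would bring its conjugate along, and the two real parts alone would exceed the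
  -- total of one.
  have him : μ.im = 0 := by
    by_contra him
    obtain ⟨m', rfl⟩ := Multiset.exists_cons_of_mem hμ
    have hne : star μ ≠ μ := by
      intro h
      exact him (Complex.conj_eq_iff_im.1 h)
    have hmem : star μ ∈ m' := by
      have := hstar μ hμ
      rw [Multiset.mem_cons] at this
      exact this.resolve_left hne
    rw [Multiset.map_cons, Multiset.sum_cons] at hsum
    have h1 := Multiset.le_sum_map_of_mem (f := Complex.re)
      (fun ν hν => hre ν (Multiset.mem_cons_of_mem hν)) hmem
    have h2 : (star μ).re = μ.re := Complex.conj_re μ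
    linarith
  refine ⟨μ.re, hμ2, ?_⟩
  have : (μ.re : ℂ) = μ := Complex.ext (by simp) (by simp [him])
  rwa [this]

/-- Tangent lines at `z` and `1 - z` give a gain of `(k+4)(z^(k+3) - (1-z)^(k+3))(x-z)`, and
Bernoulli's inequality puts the bracket above `9/10`. Of the resulting `(9/10)(k+4)(B + D/3)`, the
first part cancels the `B` loss and the second dominates the `D` loss. -/
theorem pow_add_pow_gain {x z B D : ℝ} (k : ℕ) (hB0 : 0 ≤ B) (hD0 : 0 ≤ D) (hz1 : z ≤ 1)
    (hw : (1 - z) * (k + 4) ≤ 3 / 40) (hx1 : x ≤ 1) (hgain : B + D / 3 ≤ x - z) :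
    z ^ (k + 3 + 1) + (1 - z) ^ (k + 3 + 1) ≤ x ^ (k + 3 + 1) + (1 - x) ^ (k + 3 + 1) -
      (1 - x) ^ (k + 1) * ((k + 3) / 2) * D - 9 / 10 * (k + 4) * B := by
  have hk : (0 : ℝ) ≤ k := Nat.cast_nonneg k
  have hkD : 0 ≤ k * D := mul_nonneg hk hD0
  have hw3 : 1 - z ≤ 3 / 160 := by
    linarith [mul_nonneg hk (sub_nonneg.2 hz1)]
  have hxz : z ≤ x := by linarith
  have hy0 : 0 ≤ 1 - x := by linarith
  have hyk : (1 - x) ^ (k + 1) ≤ 3 / 160 :=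
    (pow_le_of_le_one hy0 (by linarith) (by omega)).trans (by linarith)
  have hpow : (1 - x) ^ (k + 1) * (((k : ℝ) + 3) / 2) * D ≤ 3 / 160 * (((k : ℝ) + 3) / 2) * D := by
    gcongr
  have t1 := tangent_le_pow (u := x) (v := z) (by linarith) (by linarith) (k + 3)
  have t2 := tangent_le_pow (u := 1 - x) (v := 1 - z) hy0 (by linarith) (k + 3)
  have b1 : 1 - (k + 3 : ℕ) * (1 - z) ≤ z ^ (k + 3) := by
    have := one_add_mul_le_pow (a := z - 1) (by linarith) (k + 3)
    simp only [add_sub_cancel] at this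
    linarith
  have b2 : (1 - z) ^ (k + 3) ≤ 1 - z := pow_le_of_le_one (by linarith) (by linarith) (by omega)
  push_cast at b1 t1 t2
  have b3 : 9 / 10 ≤ z ^ (k + 3) - (1 - z) ^ (k + 3) := by linarith
  have hxz' : 0 ≤ x - z := by linarith
  have b4 : ((k : ℝ) + 3 + 1) * (9 / 10) * (x - z) ≤
      ((k : ℝ) + 3 + 1) * (z ^ (k + 3) - (1 - z) ^ (k + 3)) * (x - z) := by
    gcongr
  have b5 : ((k : ℝ) + 3 + 1) * (9 / 10) * (B + D / 3) ≤ ((k : ℝ) + 3 + 1) * (9 / 10) * (x - z) := by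
    gcongr
  linarith

theorem powerSum_ge_of_powerSum_three_ge {ℓ : ℕ} (hℓ : 4 ≤ ℓ) (hmod : ¬ ℓ ≡ 2 [MOD 4])
    {m : Multiset ℂ} (hre : ∀ μ ∈ m, 0 ≤ μ.re) (him : ∀ μ ∈ m, μ.im ^ 2 ≤ 1 / 2)
    (hstar : ∀ μ ∈ m, star μ ∈ m) (hsum : (m.map Complex.re).sum = 1)
    {z : ℝ} (hz0 : 1 / 2 ≤ z) (hz1 : z ≤ 1) (hz : 1 - z ≤ 3 / (10 * (ℓ : ℝ) ^ 2))
    (h3 : z ^ 3 + (1 - z) ^ 3 ≤ (m.map fun μ => (μ ^ 3).re).sum) :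
    z ^ ℓ + (1 - z) ^ ℓ ≤ (m.map fun μ => (μ ^ ℓ).re).sum := by
  have hL : (4 : ℝ) ≤ ℓ := by exact_mod_cast hℓ
  have hL2 : (16 : ℝ) ≤ (ℓ : ℝ) ^ 2 := by nlinarith
  have hw1 : (1 - z) * (ℓ : ℝ) ^ 2 ≤ 3 / 10 := by
    rw [le_div_iff₀ (by positivity)] at hz; linarith
  have hw2 : (1 - z) * ℓ ≤ 3 / 40 := by
    nlinarith [mul_le_mul_of_nonneg_left hL (mul_nonneg (sub_nonneg.2 hz1) (by linarith : (0:ℝ) ≤ ℓ))]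
  have hw3 : 1 - z ≤ 3 / 160 := by nlinarith
  obtain ⟨x, hx, hxm⟩ := exists_real_mem_of_powerSum_three hre hstar hsum
    (le_trans (by nlinarith) h3)
  obtain ⟨m', rfl⟩ := Multiset.exists_cons_of_mem hxm
  have hre' : ∀ μ ∈ m', 0 ≤ μ.re := fun μ hμ => hre μ (Multiset.mem_cons_of_mem hμ)
  rw [Multiset.map_cons, Multiset.sum_cons, Complex.ofReal_re] at hsum
  rw [Multiset.map_cons, Multiset.sum_cons, ← Complex.ofReal_pow, Complex.ofReal_re] at h3 ⊢
  have hy : (m'.map Complex.re).sum = 1 - x := by linarith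
  have hy0 : 0 ≤ 1 - x := hy ▸ m'.sum_map_nonneg_of_mem _ hre'
  set B := (m'.map fun μ => μ.re * μ.im ^ 2).sum with hB
  have hB0 : 0 ≤ B := m'.sum_map_nonneg_of_mem _ fun μ hμ => mul_nonneg (hre' μ hμ) (sq_nonneg _)
  have h3' : (m'.map fun μ => (μ ^ 3).re).sum = (m'.map fun μ => μ.re ^ 3).sum - 3 * B := by
    simp only [Complex.re_pow_three]
    rw [Multiset.sum_map_sub, Multiset.sum_map_mul_left]
  set C := (m'.map fun μ => μ.re ^ 3).sum with hC
  have hCle : C ≤ (1 - x) ^ 3 := by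
    have hle : ∀ μ ∈ m', μ.re ^ 3 ≤ μ.re * (1 - x) ^ 2 := by
      intro μ hμ
      have h0 := hre' μ hμ
      have h1 : μ.re ≤ 1 - x := hy ▸ Multiset.le_sum_map_of_mem hre' hμ
      have : μ.re ^ 2 ≤ (1 - x) ^ 2 := pow_le_pow_left₀ h0 h1 2
      nlinarith [mul_le_mul_of_nonneg_left this h0]
    have h2 := Multiset.sum_map_le_sum_map _ _ hle
    rw [Multiset.sum_map_mul_right, show (m'.map fun μ => μ.re).sum = 1 - x from hy] at h2
    linarith [h2, show (1 - x) * (1 - x) ^ 2 = (1 - x) ^ 3 by ring]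
  set D := (1 - x) ^ 3 - C with hD
  have hD0 : 0 ≤ D := by linarith
  -- Uses `z³ + (1-z)³ = 1 - 3z(1-z)`, the same for `x`, and `z(1-z) - x(1-x) = (x-z)(x+z-1)`.
  have hmain : B + D / 3 ≤ (x - z) * (x + z - 1) := by
    rw [h3'] at h3
    nlinarith
  have hxz : z ≤ x := by
    by_contra! hlt
    have : (x - z) * (x + z - 1) < 0 := mul_neg_of_neg_of_pos (by linarith) (by linarith)
    linarith
  have hgain : B + D / 3 ≤ x - z := by nlinarith
  have hterm : ∀ μ ∈ m', μ.re ^ ℓ - 9 / 10 * ℓ * (μ.re * μ.im ^ 2) ≤ (μ ^ ℓ).re := by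
    intro μ hμ
    have h1 : μ.re ≤ 1 - x := hy ▸ Multiset.le_sum_map_of_mem hre' hμ
    exact re_pow_ge_of_le hℓ hmod (hre' μ hμ) (by linarith) (him μ (Multiset.mem_cons_of_mem hμ))
  have hlow := Multiset.sum_map_le_sum_map _ _ hterm
  rw [Multiset.sum_map_sub, Multiset.sum_map_mul_left, ← hB] at hlow
  obtain ⟨k, rfl⟩ : ∃ k, ℓ = k + 3 + 1 := ⟨ℓ - 4, by omega⟩
  have hpow : (1 - x) ^ (k + 3 + 1) - (m'.map fun μ => μ.re ^ (k + 3 + 1)).sum ≤ _ :=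
    m'.pow_sum_sub_sum_pow_le hre' hy (k + 1)
  rw [← hC, ← hD] at hpow
  push_cast at hpow hlow hw2
  have hfin := pow_add_pow_gain k hB0 hD0 hz1 (by linarith) (by linarith) hgain
  have e1 : (k : ℝ) + 1 + 2 = k + 3 := by ring
  have e2 : (k : ℝ) + 3 + 1 = k + 4 := by ring
  rw [e1] at hpow
  rw [e2] at hlow
  clear_value B C D
  linarith

end SpectralInequality

/-! ### The spectrum of a tournament -/

section TournamentSpectrum

open Matrix

variable {V : Type*} [Fintype V] [DecidableEq V]

theorem sum_mul_comm_antisymm (N : Matrix V V ℝ) (p q : V → ℝ) :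
    p ⬝ᵥ (N *ᵥ q) - q ⬝ᵥ (N *ᵥ p) =
      1 / 2 * ∑ e : V × V, (N e.1 e.2 - N e.2 e.1) * (p e.1 * q e.2 - q e.1 * p e.2) := by
  have h1 : p ⬝ᵥ (N *ᵥ q) = ∑ e : V × V, N e.1 e.2 * (p e.1 * q e.2) := by
    rw [Fintype.sum_prod_type]
    simp only [dotProduct, mulVec, Finset.mul_sum]
    exact Finset.sum_congr rfl fun _ _ => Finset.sum_congr rfl fun _ _ => by ring
  have h2 : q ⬝ᵥ (N *ᵥ p) = ∑ e : V × V, N e.1 e.2 * (q e.1 * p e.2) := by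
    rw [Fintype.sum_prod_type]
    simp only [dotProduct, mulVec, Finset.mul_sum]
    exact Finset.sum_congr rfl fun _ _ => Finset.sum_congr rfl fun _ _ => by ring
  have h3 : ∀ f : V × V → ℝ, ∑ e : V × V, f e.swap = ∑ e, f e := fun f =>
    (Equiv.prodComm V V).sum_comp f
  have h1' := h3 fun e => N e.1 e.2 * (p e.1 * q e.2)
  have h2' := h3 fun e => N e.1 e.2 * (q e.1 * p e.2)
  simp only [Prod.fst_swap, Prod.snd_swap] at h1' h2'
  have h4 : ∑ e : V × V, (N e.1 e.2 - N e.2 e.1) * (p e.1 * q e.2 - q e.1 * p e.2) =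
      ∑ e : V × V, N e.1 e.2 * (p e.1 * q e.2) - ∑ e : V × V, N e.1 e.2 * (q e.1 * p e.2)
      - ∑ e : V × V, N e.2 e.1 * (q e.2 * p e.1) + ∑ e : V × V, N e.2 e.1 * (p e.2 * q e.1) := by
    rw [← Finset.sum_sub_distrib, ← Finset.sum_sub_distrib, ← Finset.sum_add_distrib]
    exact Finset.sum_congr rfl fun _ _ => by ring
  rw [h4, h1', h2', h1, h2]
  ring

/-- The symmetric part of `N` is `c/2` times the all-ones matrix, so the form equals `(c/2)(∑ p)²`.
-/
theorem dotProduct_mulVec_self_nonneg {N : Matrix V V ℝ} {c : ℝ} (hc : 0 ≤ c)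
    (hadd : ∀ u v, N u v + N v u = c) (p : V → ℝ) : 0 ≤ p ⬝ᵥ (N *ᵥ p) := by
  have h1 : p ⬝ᵥ (N *ᵥ p) = ∑ u, ∑ v, N u v * (p u * p v) := by
    simp only [dotProduct, mulVec, Finset.mul_sum]
    exact Finset.sum_congr rfl fun _ _ => Finset.sum_congr rfl fun _ _ => by ring
  have h2 : ∑ u, ∑ v, N u v * (p u * p v) = ∑ u, ∑ v, N v u * (p u * p v) := by
    rw [Finset.sum_comm]
    exact Finset.sum_congr rfl fun _ _ => Finset.sum_congr rfl fun _ _ => by ring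
  have h3 : p ⬝ᵥ (N *ᵥ p) + p ⬝ᵥ (N *ᵥ p) = c * (∑ u, p u) ^ 2 := by
    rw [h1]
    nth_rewrite 2 [h2]
    rw [ ← Finset.sum_add_distrib, sq, Finset.sum_mul_sum, Finset.mul_sum]
    refine Finset.sum_congr rfl fun u _ => ?_
    rw [← Finset.sum_add_distrib, Finset.mul_sum]
    refine Finset.sum_congr rfl fun v _ => ?_
    rw [← hadd u v]; ring
  have : 0 ≤ c * (∑ u, p u) ^ 2 := by positivity
  linarith

/-- Cauchy–Schwarz over pairs of vertices, followed by Lagrange's identity for `∑ (p_u q_v - q_u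
p_v)²`. -/
theorem sq_antisymm_form_le {N : Matrix V V ℝ} {c : ℝ}
    (hsub : ∀ u v, |N u v - N v u| ≤ c) (p q : V → ℝ) :
    (p ⬝ᵥ (N *ᵥ q) - q ⬝ᵥ (N *ᵥ p)) ^ 2 ≤
      (c * Fintype.card V) ^ 2 / 8 * (p ⬝ᵥ p + q ⬝ᵥ q) ^ 2 := by
  rw [sum_mul_comm_antisymm, mul_pow]
  have hcs := Finset.sum_mul_sq_le_sq_mul_sq (Finset.univ : Finset (V × V))
    (fun e => N e.1 e.2 - N e.2 e.1) (fun e => p e.1 * q e.2 - q e.1 * p e.2)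
  have h1 : ∑ e : V × V, (N e.1 e.2 - N e.2 e.1) ^ 2 ≤ (c * Fintype.card V) ^ 2 := by
    calc ∑ e : V × V, (N e.1 e.2 - N e.2 e.1) ^ 2 ≤ ∑ _e : V × V, c ^ 2 :=
          Finset.sum_le_sum fun e _ => sq_le_sq' (abs_le.1 (hsub _ _)).1 (abs_le.1 (hsub _ _)).2
      _ = _ := by simp; ring
  have h2 : ∑ e : V × V, (p e.1 * q e.2 - q e.1 * p e.2) ^ 2 =
      2 * (p ⬝ᵥ p * q ⬝ᵥ q - (p ⬝ᵥ q) ^ 2) := by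
    have e1 : p ⬝ᵥ p * q ⬝ᵥ q = ∑ e : V × V, p e.1 ^ 2 * q e.2 ^ 2 := by
      rw [Fintype.sum_prod_type, dotProduct, dotProduct, Finset.sum_mul_sum]
      exact Finset.sum_congr rfl fun _ _ => Finset.sum_congr rfl fun _ _ => by ring
    have e2 : q ⬝ᵥ q * p ⬝ᵥ p = ∑ e : V × V, q e.1 ^ 2 * p e.2 ^ 2 := by
      rw [Fintype.sum_prod_type, dotProduct, dotProduct, Finset.sum_mul_sum]
      exact Finset.sum_congr rfl fun _ _ => Finset.sum_congr rfl fun _ _ => by ring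
    have e3 : (p ⬝ᵥ q) ^ 2 = ∑ e : V × V, p e.1 * q e.1 * (p e.2 * q e.2) := by
      rw [Fintype.sum_prod_type, sq, dotProduct, Finset.sum_mul_sum]
    have e4 : 2 * (p ⬝ᵥ p * q ⬝ᵥ q - (p ⬝ᵥ q) ^ 2) =
        p ⬝ᵥ p * q ⬝ᵥ q + q ⬝ᵥ q * p ⬝ᵥ p - 2 * (p ⬝ᵥ q) ^ 2 := by ring
    rw [e4, e1, e2, e3, Finset.mul_sum, ← Finset.sum_add_distrib, ← Finset.sum_sub_distrib]
    exact Finset.sum_congr rfl fun _ _ => by ring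
  have h3 : 2 * (p ⬝ᵥ p * q ⬝ᵥ q - (p ⬝ᵥ q) ^ 2) ≤ 1 / 2 * (p ⬝ᵥ p + q ⬝ᵥ q) ^ 2 := by
    nlinarith [sq_nonneg (p ⬝ᵥ p - q ⬝ᵥ q), sq_nonneg (p ⬝ᵥ q)]
  have h4 : 0 ≤ 2 * (p ⬝ᵥ p * q ⬝ᵥ q - (p ⬝ᵥ q) ^ 2) := by rw [← h2]; positivity
  rw [h2] at hcs
  have h5 := mul_le_mul h1 h3 h4 (by positivity)
  linarith

theorem exists_real_eigenvector_pair {N : Matrix V V ℝ} {μ : ℂ}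
    (hμ : μ ∈ (N.map (algebraMap ℝ ℂ)).charpoly.roots) :
    ∃ p q : V → ℝ, 0 < p ⬝ᵥ p + q ⬝ᵥ q ∧ N *ᵥ p = μ.re • p - μ.im • q ∧
      N *ᵥ q = μ.re • q + μ.im • p := by
  have hroot := Polynomial.isRoot_of_mem_roots hμ
  rw [Polynomial.IsRoot, Matrix.eval_charpoly, ← Matrix.exists_mulVec_eq_zero_iff] at hroot
  obtain ⟨v, hv0, hv⟩ := hroot
  have hv' : ∀ u, ∑ w, (N u w : ℂ) * v w = μ * v u := by
    intro u
    have := congrFun hv u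
    rw [Matrix.sub_mulVec, Pi.sub_apply, Pi.zero_apply, sub_eq_zero] at this
    rw [Matrix.scalar_apply, Matrix.mulVec_diagonal] at this
    rw [this]
    simp [mulVec, dotProduct]
  refine ⟨fun u => (v u).re, fun u => (v u).im, ?_, ?_, ?_⟩
  · obtain ⟨u, hu⟩ := Function.ne_iff.1 hv0
    have h : ∀ f : V → ℝ, f u * f u ≤ f ⬝ᵥ f := fun f =>
      Finset.single_le_sum (f := fun i => f i * f i) (fun i _ => mul_self_nonneg _)
        (Finset.mem_univ u)
    have h1 := h fun u => (v u).re
    have h2 := h fun u => (v u).im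
    have h3 : 0 < Complex.normSq (v u) := Complex.normSq_pos.2 hu
    rw [Complex.normSq_apply] at h3
    linarith
  · ext u
    have := congrArg Complex.re (hv' u)
    simpa [mulVec, dotProduct] using this
  · ext u
    have := congrArg Complex.im (hv' u)
    simpa [mulVec, dotProduct] using this

/-- For an eigenvector `p + iq`, adding the quadratic forms of `N` at `p` and `q` isolates `μ.re`,
and the antisymmetric form at `(p, q)` isolates `μ.im`, each times `|p|² + |q|²`. -/
theorem eigenvalue_bounds {N : Matrix V V ℝ} {c : ℝ} (hc : c * Fintype.card V = 2)
    (hadd : ∀ u v, N u v + N v u = c) (hsub : ∀ u v, |N u v - N v u| ≤ c) {μ : ℂ}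
    (hμ : μ ∈ (N.map (algebraMap ℝ ℂ)).charpoly.roots) : 0 ≤ μ.re ∧ μ.im ^ 2 ≤ 1 / 2 := by
  obtain ⟨p, q, hpos, hp, hq⟩ := exists_real_eigenvector_pair hμ
  have hc0 : 0 ≤ c := by
    by_contra! h
    have : c * Fintype.card V ≤ 0 := mul_nonpos_of_nonpos_of_nonneg h.le (by positivity)
    linarith
  constructor
  · have h1 := dotProduct_mulVec_self_nonneg hc0 hadd p
    have h2 := dotProduct_mulVec_self_nonneg hc0 hadd q
    rw [hp, dotProduct_sub, dotProduct_smul, dotProduct_smul, smul_eq_mul, smul_eq_mul] at h1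
    rw [hq, dotProduct_add, dotProduct_smul, dotProduct_smul, smul_eq_mul, smul_eq_mul,
      dotProduct_comm q p] at h2
    by_contra! h
    nlinarith
  · have h := sq_antisymm_form_le hsub p q
    rw [hc, hp, hq, dotProduct_add, dotProduct_sub] at h
    simp only [dotProduct_smul, smul_eq_mul] at h
    rw [dotProduct_comm q p] at h
    have e : μ.re * p ⬝ᵥ q + μ.im * p ⬝ᵥ p - (μ.re * p ⬝ᵥ q - μ.im * q ⬝ᵥ q) =
      μ.im * (p ⬝ᵥ p + q ⬝ᵥ q) := by ring
    rw [e, mul_pow] at h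
    have h2 : (0 : ℝ) < (p ⬝ᵥ p + q ⬝ᵥ q) ^ 2 := by positivity
    refine le_of_mul_le_mul_right ?_ h2
    linarith

theorem trace_pow_eq_sum_re (N : Matrix V V ℝ) (k : ℕ) :
    (N ^ k).trace = ((N.map (algebraMap ℝ ℂ)).charpoly.roots.map fun μ => (μ ^ k).re).sum := by
  have h := (N.map (algebraMap ℝ ℂ)).trace_pow_eq_sum_roots_charpoly k
  have h1 : (N.map (algebraMap ℝ ℂ)) ^ k = (N ^ k).map (algebraMap ℝ ℂ) :=
    (map_pow (algebraMap ℝ ℂ).mapMatrix N k).symm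
  have h2 : ((N ^ k).map (algebraMap ℝ ℂ)).trace = (((N ^ k).trace : ℝ) : ℂ) := by
    simp [Matrix.trace]
  rw [h1, h2] at h
  have h3 := congrArg Complex.re h
  rw [Complex.ofReal_re] at h3
  rw [h3]
  change Complex.reAddGroupHom _ = _
  rw [map_multiset_sum, Multiset.map_map]
  rfl

/-- The real matrix `A + 1/2`, where `A` is the adjacency matrix. -/
noncomputable def Digraph.halfLoopMatrix (T : Digraph V) : Matrix V V ℝ :=
  T.realAdjMatrix + (1 / 2 : ℝ) • 1

theorem Digraph.realAdjMatrix_mem (T : Digraph V) (u v : V) :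
    0 ≤ T.realAdjMatrix u v ∧ T.realAdjMatrix u v ≤ 1 := by
  simp only [Digraph.realAdjMatrix, Matrix.of_apply]
  split_ifs <;> norm_num

theorem IsTournament.realAdjMatrix_self {T : Digraph V} (hT : IsTournament T) (u : V) :
    T.realAdjMatrix u u = 0 := by
  simp [Digraph.realAdjMatrix, hT.loopless u]

theorem IsTournament.realAdjMatrix_add {T : Digraph V} (hT : IsTournament T) {u v : V}
    (h : u ≠ v) : T.realAdjMatrix u v + T.realAdjMatrix v u = 1 := by
  simp only [Digraph.realAdjMatrix, Matrix.of_apply]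
  rcases hT.oriented u v h with ⟨h1, h2⟩ | ⟨h1, h2⟩ <;> simp [h1, h2]

theorem IsTournament.halfLoopMatrix_add {T : Digraph V} (hT : IsTournament T) (u v : V) :
    T.halfLoopMatrix u v + T.halfLoopMatrix v u = 1 := by
  simp only [Digraph.halfLoopMatrix, Matrix.add_apply, Matrix.smul_apply, smul_eq_mul]
  by_cases h : u = v
  · subst h
    simp only [hT.realAdjMatrix_self, Matrix.one_apply_eq]
    norm_num
  · rw [Matrix.one_apply_ne h, Matrix.one_apply_ne (Ne.symm h)]
    linarith [hT.realAdjMatrix_add h]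

theorem IsTournament.halfLoopMatrix_mem {T : Digraph V} (hT : IsTournament T) (u v : V) :
    0 ≤ T.halfLoopMatrix u v ∧ T.halfLoopMatrix u v ≤ 1 := by
  have h : ∀ u v, 0 ≤ T.halfLoopMatrix u v := by
    intro u v
    simp only [Digraph.halfLoopMatrix, Matrix.add_apply, Matrix.smul_apply, smul_eq_mul,
      Matrix.one_apply]
    have := (T.realAdjMatrix_mem u v).1
    split_ifs <;> linarith
  exact ⟨h u v, by linarith [h v u, hT.halfLoopMatrix_add u v]⟩

end TournamentSpectrum

/-! ### Traces of powers of matrices with entries in the unit interval -/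

section TraceComparison

open Matrix

variable {V : Type*} [Fintype V] [DecidableEq V]

theorem mul_entry_bound {X Y : Matrix V V ℝ} (hX : ∀ u v, 0 ≤ X u v ∧ X u v ≤ 1) {c : ℝ}
    (hY : ∀ u v, 0 ≤ Y u v ∧ Y u v ≤ c) (u v : V) :
    0 ≤ (X * Y) u v ∧ (X * Y) u v ≤ Fintype.card V * c := by
  rw [Matrix.mul_apply]
  refine ⟨Finset.sum_nonneg fun w _ => mul_nonneg (hX u w).1 (hY w v).1, ?_⟩
  calc ∑ w, X u w * Y w v ≤ ∑ _w : V, c := Finset.sum_le_sum fun w _ => by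
        nlinarith [(hX u w).1, (hX u w).2, (hY w v).1, (hY w v).2]
    _ = _ := by simp

theorem pow_mul_pow_entry_bound {A M : Matrix V V ℝ} (hA : ∀ u v, 0 ≤ A u v ∧ A u v ≤ 1)
    (hM : ∀ u v, 0 ≤ M u v ∧ M u v ≤ 1) (k j : ℕ) (u v : V) :
    0 ≤ (M ^ k * A ^ (j + 1)) u v ∧
      (M ^ k * A ^ (j + 1)) u v ≤ (Fintype.card V : ℝ) ^ (k + j) := by
  induction k generalizing u v with
  | zero =>
    induction j generalizing u v with
    | zero => simpa using hA u v
    | succ j ih =>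
      have := mul_entry_bound hA ih u v
      simp only [pow_zero, Matrix.one_mul, zero_add, ← pow_succ'] at this ⊢
      exact this
  | succ k ih =>
    have := mul_entry_bound hM ih u v
    rw [← Matrix.mul_assoc, ← pow_succ', ← pow_succ'] at this
    rwa [show k + 1 + j = k + j + 1 by omega]

theorem trace_pow_mul_pow_le {A M : Matrix V V ℝ} (hA : ∀ u v, 0 ≤ A u v ∧ A u v ≤ 1)
    (hM : ∀ u v, 0 ≤ M u v ∧ M u v ≤ 1) (k j : ℕ) :
    (M ^ k * A ^ (j + 1)).trace ≤ (Fintype.card V : ℝ) ^ (k + j + 1) := by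
  calc (M ^ k * A ^ (j + 1)).trace ≤ ∑ _u : V, (Fintype.card V : ℝ) ^ (k + j) :=
        Finset.sum_le_sum fun u _ => (pow_mul_pow_entry_bound hA hM k j u u).2
    _ = _ := by simp; ring

/-- The factors `M` are replaced by `A` one at a time; each of the `k + 2` replacements costs half
the trace of a product of `k + 1` matrices with entries in `[0,1]`. -/
theorem trace_add_half_pow_le {A M : Matrix V V ℝ} (hA : ∀ u v, 0 ≤ A u v ∧ A u v ≤ 1)
    (hM : ∀ u v, 0 ≤ M u v ∧ M u v ≤ 1) (hAM : M = A + (1 / 2 : ℝ) • 1) (k : ℕ) :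
    (M ^ (k + 2)).trace ≤ (A ^ (k + 2)).trace + (k + 2) / 2 * (Fintype.card V : ℝ) ^ (k + 1) := by
  have step : ∀ k j : ℕ, (M ^ (k + 1) * A ^ j).trace =
      (M ^ k * A ^ (j + 1)).trace + 1 / 2 * (M ^ k * A ^ j).trace := by
    intro k j
    rw [pow_succ M k, Matrix.mul_assoc]
    nth_rewrite 2 [hAM]
    rw [Matrix.add_mul, Matrix.mul_add, Matrix.trace_add, ← pow_succ', Matrix.smul_mul,
      Matrix.one_mul, Matrix.mul_smul, Matrix.trace_smul, smul_eq_mul]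
  have key : ∀ k j : ℕ, (M ^ k * A ^ (j + 1)).trace ≤
      (A ^ (k + j + 1)).trace + k / 2 * (Fintype.card V : ℝ) ^ (k + j) := by
    intro k
    induction k with
    | zero => intro j; simp
    | succ k ih =>
      intro j
      rw [step]
      have h1 := ih (j + 1)
      have h2 := trace_pow_mul_pow_le hA hM k j
      rw [show k + 1 + j = k + j + 1 by omega]
      rw [show k + (j + 1) = k + j + 1 by omega] at h1
      push_cast
      linarith
  have h1 := key (k + 1) 0
  -- The first replacement leaves a pure power of `M`, so `M` plays both roles in the bound.
  have h2 := trace_pow_mul_pow_le hM hM k 0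
  have h3 := step (k + 1) 0
  simp only [pow_zero, Matrix.mul_one, zero_add, add_zero, pow_one] at h1 h2 h3
  rw [← pow_succ] at h2
  push_cast at h1
  rw [show k + 2 = k + 1 + 1 by omega, h3]
  linarith

theorem trace_pow_mono {A M : Matrix V V ℝ} (hA : ∀ u v, 0 ≤ A u v)
    (hAM : ∀ u v, A u v ≤ M u v) (k : ℕ) : (A ^ k).trace ≤ (M ^ k).trace := by
  have key : ∀ u v, 0 ≤ (A ^ k) u v ∧ (A ^ k) u v ≤ (M ^ k) u v := by
    induction k with
    | zero =>
      intro u v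
      simp only [pow_zero, Matrix.one_apply, le_refl, and_true]
      split_ifs <;> norm_num
    | succ k ih =>
      intro u v
      rw [pow_succ, pow_succ, Matrix.mul_apply, Matrix.mul_apply]
      exact ⟨Finset.sum_nonneg fun w _ => mul_nonneg (ih u w).1 (hA w v),
        Finset.sum_le_sum fun w _ => mul_le_mul (ih u w).2 (hAM w v) (hA w v)
          ((ih u w).1.trans (ih u w).2)⟩
  exact Finset.sum_le_sum fun u _ => (key u u).2

/-- The matrix of a tournament with half loops, scaled to have trace one. -/
noncomputable def Digraph.normalizedMatrix (T : Digraph V) : Matrix V V ℝ :=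
  (2 / Fintype.card V : ℝ) • T.halfLoopMatrix

theorem Digraph.trace_normalizedMatrix_pow (T : Digraph V) (k : ℕ) :
    (T.normalizedMatrix ^ k).trace =
      2 ^ k * ((T.halfLoopMatrix ^ k).trace / (Fintype.card V : ℝ) ^ k) := by
  rw [Digraph.normalizedMatrix, smul_pow, Matrix.trace_smul, smul_eq_mul, div_pow]
  ring

theorem Digraph.cycleDensity_le_trace (T : Digraph V) {k : ℕ} (hk : 0 < k) : 2 ^ k * cycleDensity k T ≤ (T.normalizedMatrix ^ k).trace := by
  rw [T.trace_normalizedMatrix_pow, cycleDensity_eq_trace T hk]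
  gcongr
  refine trace_pow_mono (fun u v => (T.realAdjMatrix_mem u v).1) (fun u v => ?_) k
  simp only [Digraph.halfLoopMatrix, Matrix.add_apply, Matrix.smul_apply, smul_eq_mul,
    Matrix.one_apply]
  split_ifs <;> linarith

theorem IsTournament.trace_le_cycleDensity {T : Digraph V} [Nonempty V] (hT : IsTournament T)
    {k : ℕ} (hk : 2 ≤ k) :
    (T.normalizedMatrix ^ k).trace ≤ 2 ^ k * (cycleDensity k T + k / 2 / Fintype.card V) := by
  obtain ⟨m, rfl⟩ : ∃ m, k = m + 2 := ⟨k - 2, by omega⟩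
  rw [T.trace_normalizedMatrix_pow, cycleDensity_eq_trace T (by omega)]
  have hn : (0 : ℝ) < Fintype.card V := by exact_mod_cast Fintype.card_pos
  gcongr
  rw [div_le_iff₀ (by positivity), add_mul, div_mul_cancel₀ _ (by positivity)]
  have := trace_add_half_pow_le T.realAdjMatrix_mem hT.halfLoopMatrix_mem rfl m
  refine this.trans (le_of_eq ?_)
  push_cast
  congr 1
  rw [pow_succ (Fintype.card V : ℝ) (m + 1)]
  field_simp

variable [Nonempty V] {T : Digraph V}

theorem IsTournament.normalizedMatrix_eigenvalue_bounds (hT : IsTournament T) {μ : ℂ}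
    (hμ : μ ∈ (T.normalizedMatrix.map (algebraMap ℝ ℂ)).charpoly.roots) :
    0 ≤ μ.re ∧ μ.im ^ 2 ≤ 1 / 2 := by
  have hn : (0 : ℝ) < Fintype.card V := by exact_mod_cast Fintype.card_pos
  refine eigenvalue_bounds (c := 2 / Fintype.card V) (by field_simp) ?_ ?_ hμ
  · intro u v
    simp only [Digraph.normalizedMatrix, Matrix.smul_apply, smul_eq_mul]
    rw [← mul_add, hT.halfLoopMatrix_add, mul_one]
  · intro u v
    simp only [Digraph.normalizedMatrix, Matrix.smul_apply, smul_eq_mul]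
    rw [← mul_sub, abs_mul, abs_of_nonneg (by positivity)]
    have h1 := hT.halfLoopMatrix_mem u v
    have h2 := hT.halfLoopMatrix_mem v u
    refine mul_le_of_le_one_right (by positivity) (abs_le.2 ⟨?_, ?_⟩) <;> linarith

theorem IsTournament.sum_re_eigenvalues (hT : IsTournament T) :
    ((T.normalizedMatrix.map (algebraMap ℝ ℂ)).charpoly.roots.map Complex.re).sum = 1 := by
  have hn : (0 : ℝ) < Fintype.card V := by exact_mod_cast Fintype.card_pos
  have h := trace_pow_eq_sum_re T.normalizedMatrix 1
  simp only [pow_one] at h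
  rw [← h, Digraph.normalizedMatrix, Matrix.trace_smul, Digraph.halfLoopMatrix, Matrix.trace_add,
    Matrix.trace_smul, Matrix.trace_one]
  have : T.realAdjMatrix.trace = 0 := Finset.sum_eq_zero fun u _ => hT.realAdjMatrix_self u
  rw [this, smul_eq_mul, smul_eq_mul]
  field_simp
  ring

/-- Each eigenvalue has real part `a ∈ [0,1]`, so `Re μ³ ≤ a³ ≤ a`, and these `a` sum to one. -/
theorem IsTournament.trace_pow_three_le_one (hT : IsTournament T) :
    (T.normalizedMatrix ^ 3).trace ≤ 1 := by
  rw [trace_pow_eq_sum_re, ← hT.sum_re_eigenvalues]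
  refine Multiset.sum_map_le_sum_map _ _ fun μ hμ => ?_
  have h0 := (hT.normalizedMatrix_eigenvalue_bounds hμ).1
  have h1 : μ.re ≤ 1 := hT.sum_re_eigenvalues (T := T) ▸ Multiset.le_sum_map_of_mem
    (fun ν hν => (hT.normalizedMatrix_eigenvalue_bounds hν).1) hμ
  rw [Complex.re_pow_three]
  have h2 := mul_nonneg h0 (sq_nonneg μ.im)
  have h3 : μ.re ^ 3 ≤ μ.re := pow_le_of_le_one h0 h1 (by norm_num)
  linarith

theorem IsTournament.cycleDensity_three_le (hT : IsTournament T) : cycleDensity 3 T ≤ 1 / 8 := by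
  have h1 := T.cycleDensity_le_trace (k := 3) (by norm_num)
  have h2 := hT.trace_pow_three_le_one
  linarith

theorem IsTournament.trace_pow_ge (hT : IsTournament T) {ℓ : ℕ} (hℓ : 4 ≤ ℓ)
    (hmod : ¬ ℓ ≡ 2 [MOD 4]) {z : ℝ} (hz0 : 1 / 2 ≤ z) (hz1 : z ≤ 1)
    (hz : 1 - z ≤ 3 / (10 * (ℓ : ℝ) ^ 2)) (h3 : z ^ 3 + (1 - z) ^ 3 ≤ 8 * cycleDensity 3 T) :
    z ^ ℓ + (1 - z) ^ ℓ ≤ (T.normalizedMatrix ^ ℓ).trace := by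
  rw [trace_pow_eq_sum_re]
  refine powerSum_ge_of_powerSum_three_ge hℓ hmod
    (fun μ hμ => (hT.normalizedMatrix_eigenvalue_bounds hμ).1)
    (fun μ hμ => (hT.normalizedMatrix_eigenvalue_bounds hμ).2)
    (fun μ hμ => T.normalizedMatrix.star_mem_roots_charpoly hμ)
    hT.sum_re_eigenvalues hz0 hz1 hz ?_
  rw [← trace_pow_eq_sum_re]
  have := T.cycleDensity_le_trace (k := 3) (by norm_num)
  linarith

end TraceComparison

/-! ### An explicit formula for the extremal function -/

section ExtremalFunction

/-- The size of the larger part of the two-part construction whose density of triangles is `s`. -/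
noncomputable def splitPoint (s : ℝ) : ℝ := (1 + √(1 - 4 * (1 - 8 * s) / 3)) / 2

theorem continuous_splitPoint : Continuous splitPoint := by
  unfold splitPoint
  fun_prop

/-- The product equation is `z³ + (1-z)³ = 8s` rewritten through `z³ + (1-z)³ = 1 - 3z(1-z)`. -/
theorem splitPoint_spec {s : ℝ} (h0 : 1 / 16 ≤ s) (h1 : s ≤ 1 / 8) :
    1 / 2 < splitPoint s ∧ splitPoint s ≤ 1 ∧
      splitPoint s * (1 - splitPoint s) = (1 - 8 * s) / 3 := by
  have hpos : 0 < 1 - 4 * (1 - 8 * s) / 3 := by linarith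
  have hsq := Real.sq_sqrt hpos.le
  have hsp := Real.sqrt_pos.2 hpos
  have hle : √(1 - 4 * (1 - 8 * s) / 3) ≤ 1 := Real.sqrt_le_one.2 (by linarith)
  unfold splitPoint
  refine ⟨by linarith, by linarith, by nlinarith⟩

theorem partPowerSum_of_half_lt (p : ℕ) {z : ℝ} (h0 : 1 / 2 < z) (h1 : z ≤ 1) :
    partPowerSum p z = z ^ p + (1 - z) ^ p := by
  have : ⌊z⁻¹⌋₊ = 1 := by
    rw [Nat.floor_eq_iff (by positivity)]
    constructor
    · simpa using (one_le_inv₀ (by linarith)).2 h1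
    · rw [inv_lt_comm₀ (by linarith) (by norm_num)]; norm_num; linarith
  rw [partPowerSum, this]; simp

theorem blowUpDensity_eq_splitPoint (ℓ : ℕ) {s : ℝ} (h0 : 1 / 16 ≤ s) (h1 : s ≤ 1 / 8) :
    blowUpDensity ℓ s = (1 / 2 ^ ℓ) * (splitPoint s ^ ℓ + (1 - splitPoint s) ^ ℓ) := by
  obtain ⟨hz0, hz1, hz⟩ := splitPoint_spec h0 h1
  have h := blowUpDensity_apply ℓ (z := splitPoint s) ⟨by linarith, hz1⟩
  rw [partPowerSum_of_half_lt _ hz0 hz1, partPowerSum_of_half_lt _ hz0 hz1] at h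
  rw [← h]
  congr 1
  linarith [show splitPoint s ^ 3 + (1 - splitPoint s) ^ 3 =
    1 - 3 * (splitPoint s * (1 - splitPoint s)) by ring]

end ExtremalFunction

/-! ### The lower bound with explicit error term -/

theorem IsTournament.blowUpDensity_le {V : Type*} [Fintype V] [Nonempty V] {T : Digraph V}
    (hT : IsTournament T) {ℓ : ℕ} (hℓ : 4 ≤ ℓ) (hmod : ¬ ℓ ≡ 2 [MOD 4])
    (h : 1 / 8 - 1 / (10 * (ℓ : ℝ) ^ 2) ≤ cycleDensity 3 T) :
    blowUpDensity ℓ (cycleDensity 3 T) ≤ cycleDensity ℓ T + ℓ / 2 / Fintype.card V := by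
  classical
  have hL : (4 : ℝ) ≤ ℓ := by exact_mod_cast hℓ
  have hL2 : (16 : ℝ) ≤ (ℓ : ℝ) ^ 2 := by nlinarith
  have hle := hT.cycleDensity_three_le
  have hq : 1 / (10 * (ℓ : ℝ) ^ 2) ≤ 1 / 160 :=
    one_div_le_one_div_of_le (by norm_num) (by linarith)
  obtain ⟨hz0, hz1, hz⟩ := splitPoint_spec (s := cycleDensity 3 T) (by linarith) hle
  rw [blowUpDensity_eq_splitPoint ℓ (by linarith) hle]
  set z := splitPoint (cycleDensity 3 T)
  -- Once `z ≥ 9/10`, dividing `z(1-z) ≤ (8/3)/(10ℓ²)` by `z` leaves the constant `80/27 < 3`.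
  have hw : 1 - z ≤ 3 / (10 * (ℓ : ℝ) ^ 2) := by
    have e : 3 / (10 * (ℓ : ℝ) ^ 2) = 3 * (1 / (10 * (ℓ : ℝ) ^ 2)) := by ring
    rw [e]
    have h1 : z * (1 - z) ≤ 8 / 3 * (1 / (10 * (ℓ : ℝ) ^ 2)) := by linarith
    have h2 : 1 - z ≤ 1 / 10 := by nlinarith
    nlinarith
  have h1 := hT.trace_pow_ge hℓ hmod hz0.le hz1 hw (by
    linarith [show z ^ 3 + (1 - z) ^ 3 = 1 - 3 * (z * (1 - z)) by ring])
  have h2 := hT.trace_le_cycleDensity (k := ℓ) (by omega)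
  rw [one_div, inv_mul_le_iff₀ (by positivity)]
  exact h1.trans h2

/-! ### Quasirandom tournaments -/

section SkewHadamard

open Matrix

theorem diag_eq_zero_of_transpose_eq_neg {V : Type*} {S : Matrix V V ℝ} (h : Sᵀ = -S) (u : V) :
    S u u = 0 := by
  have := congrFun (congrFun h u) u
  simp only [Matrix.transpose_apply, Matrix.neg_apply] at this
  linarith

/-- Skew Hadamard matrices of order `2 ^ k`, with the identity matrix subtracted. -/
theorem exists_skewHadamard (k : ℕ) : ∃ S : Matrix (Fin (2 ^ k)) (Fin (2 ^ k)) ℝ, Sᵀ = -S ∧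
    (∀ u v, u ≠ v → S u v = 1 ∨ S u v = -1) ∧ S * S = (-(2 ^ k - 1) : ℝ) • 1 := by
  induction k with
  | zero =>
    refine ⟨0, by simp, fun u v h => ?_, by simp⟩
    have hu := u.2
    have hv := v.2
    exact absurd (Fin.ext (by omega)) h
  | succ k ih =>
    obtain ⟨S, hT, hS, hSS⟩ := ih
    let e : Fin (2 ^ k) ⊕ Fin (2 ^ k) ≃ Fin (2 ^ (k + 1)) :=
      finSumFinEquiv.trans (finCongr (by ring))
    -- Doubling step: the off-diagonal blocks of `F²` vanish, and both diagonal blocks equal `2S² -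
    -- 1`.
    let F : Matrix (Fin (2 ^ k) ⊕ Fin (2 ^ k)) (Fin (2 ^ k) ⊕ Fin (2 ^ k)) ℝ :=
      fromBlocks S (1 + S) (S - 1) (-S)
    have hF : Fᵀ = -F := by
      simp only [F, fromBlocks_transpose, fromBlocks_neg, transpose_add, transpose_sub, hT,
        transpose_one, transpose_neg, neg_add, neg_sub]
      congr 1
      abel
    have hFF : F * F = (-(2 ^ (k + 1) - 1) : ℝ) • 1 := by
      have e1 : S * S + (1 + S) * (S - 1) = (-(2 ^ (k + 1) - 1) : ℝ) • 1 := by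
        have : S * S + (1 + S) * (S - 1) = (2 : ℝ) • (S * S) - 1 := by
          rw [two_smul]; noncomm_ring
        rw [this, hSS, smul_smul]
        nth_rewrite 2 [← one_smul ℝ (1 : Matrix (Fin (2 ^ k)) (Fin (2 ^ k)) ℝ)]
        rw [← sub_smul]
        congr 1
        ring
      have e2 : (S - 1) * (1 + S) + -S * -S = (-(2 ^ (k + 1) - 1) : ℝ) • 1 := by
        rw [← e1]; noncomm_ring
      have e3 : S * (1 + S) + (1 + S) * -S = 0 := by noncomm_ring
      have e4 : (S - 1) * S + -S * (S - 1) = 0 := by noncomm_ring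
      simp only [F, fromBlocks_multiply]
      rw [e1, e2, e3, e4, ← fromBlocks_one, fromBlocks_smul, smul_zero]
    have hFe : ∀ u v, u ≠ v → F u v = 1 ∨ F u v = -1 := by
      have hd := diag_eq_zero_of_transpose_eq_neg hT
      rintro (u | u) (v | v) h
      · exact hS u v fun h' => h (h' ▸ rfl)
      · by_cases huv : u = v
        · subst huv; left; simp [F, hd]
        · simpa [F, Matrix.one_apply_ne huv] using hS u v huv
      · by_cases huv : u = v
        · subst huv; right; simp [F, hd]
        · simpa [F, Matrix.one_apply_ne huv] using hS u v huv
      · rcases hS u v fun h' => h (h' ▸ rfl) with h1 | h1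
        · right; simp [F, h1]
        · left; simp [F, h1]
    refine ⟨F.submatrix e.symm e.symm, ?_, ?_, ?_⟩
    · rw [transpose_submatrix, hF]; rfl
    · intro u v h
      exact hFe _ _ fun h' => h (e.symm.injective h')
    · rw [submatrix_mul_equiv, hFF, submatrix_smul, Pi.smul_apply, Pi.smul_apply,
        submatrix_one_equiv]

end SkewHadamard

/-! ### Powers of a small perturbation of a rank-one projection -/

section TraceEstimates

open Matrix
open scoped Matrix.Norms.L2Operator

variable {V : Type*} [Fintype V] [DecidableEq V]

theorem abs_dotProduct_mulVec_le (X : Matrix V V ℝ) (p : V → ℝ) :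
    |p ⬝ᵥ (X *ᵥ p)| ≤ ‖X‖ * (p ⬝ᵥ p) := by
  have h := X.l2_opNorm_mulVec (WithLp.toLp 2 p)
  have h2 := abs_real_inner_le_norm (WithLp.toLp 2 p) (WithLp.toLp 2 (X *ᵥ p))
  have h3 : inner ℝ (WithLp.toLp 2 p) (WithLp.toLp 2 (X *ᵥ p)) = p ⬝ᵥ (X *ᵥ p) := by
    rw [EuclideanSpace.inner_toLp_toLp, dotProduct_comm]; simp
  have h4 : ‖WithLp.toLp 2 p‖ * ‖WithLp.toLp 2 p‖ = p ⬝ᵥ p := by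
    rw [← real_inner_self_eq_norm_mul_norm, EuclideanSpace.inner_toLp_toLp]; simp
  rw [h3] at h2
  calc _ ≤ _ := h2
    _ ≤ ‖WithLp.toLp 2 p‖ * (‖X‖ * ‖WithLp.toLp 2 p‖) := by gcongr; exact h
    _ = _ := by rw [← h4]; ring

theorem abs_trace_le_card_mul_norm (X : Matrix V V ℝ) : |X.trace| ≤ Fintype.card V * ‖X‖ := by
  have h : ∀ u, |X u u| ≤ ‖X‖ := by
    intro u
    have := abs_dotProduct_mulVec_le X (Pi.single u 1)
    simpa using this
  calc |X.trace| ≤ ∑ u, |X u u| := Finset.abs_sum_le_sum_abs _ _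
    _ ≤ ∑ _u : V, ‖X‖ := Finset.sum_le_sum fun u _ => h u
    _ = _ := by simp

/-- The orthogonal projection to the constant vectors. -/
noncomputable def averagingMatrix (V : Type*) [Fintype V] : Matrix V V ℝ :=
  Matrix.of fun _ _ => (Fintype.card V : ℝ)⁻¹

/-- The projection has rank one, so the trace is a single quadratic form of `X` at a unit vector and
no factor `|V|` appears. -/
theorem abs_trace_averagingMatrix_mul_le (X : Matrix V V ℝ) :
    |(averagingMatrix V * X).trace| ≤ ‖X‖ := by
  have h := abs_dotProduct_mulVec_le X (fun _ => 1)
  have e : (averagingMatrix V * X).trace = (Fintype.card V : ℝ)⁻¹ *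
      ((fun _ => 1) ⬝ᵥ (X *ᵥ fun _ => 1)) := by
    simp only [Matrix.trace, Matrix.diag, Matrix.mul_apply, averagingMatrix, Matrix.of_apply,
      dotProduct, mulVec, one_mul, mul_one, ← Finset.mul_sum]
    rw [Finset.sum_comm]
  rw [e, abs_mul, abs_of_nonneg (by positivity)]
  have e2 : (fun _ : V => (1 : ℝ)) ⬝ᵥ (fun _ => 1) = Fintype.card V := by simp [dotProduct]
  rw [e2] at h
  rcases isEmpty_or_nonempty V with hV | hV
  · simp
  · have hn : (0 : ℝ) < Fintype.card V := by exact_mod_cast Fintype.card_pos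
    rw [inv_mul_le_iff₀ hn]; linarith

variable [Nonempty V]

theorem averagingMatrix_mul_self : averagingMatrix V * averagingMatrix V = averagingMatrix V := by
  have hn : (Fintype.card V : ℝ) ≠ 0 := by exact_mod_cast Fintype.card_ne_zero
  ext u v
  simp [averagingMatrix, Matrix.mul_apply, hn]

theorem trace_averagingMatrix : (averagingMatrix V).trace = 1 := by
  have hn : (Fintype.card V : ℝ) ≠ 0 := by exact_mod_cast Fintype.card_ne_zero
  simp [averagingMatrix, Matrix.trace, hn]

theorem averagingMatrix_pow_mul (k : ℕ) :
    averagingMatrix V * averagingMatrix V ^ k = averagingMatrix V := by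
  induction k with
  | zero => simp
  | succ k ih => rw [pow_succ, ← Matrix.mul_assoc, ih, averagingMatrix_mul_self]

theorem norm_averagingMatrix_le : ‖averagingMatrix V‖ ≤ 1 := by
  have h := l2_opNorm_conjTranspose_mul_self (averagingMatrix V)
  have e : (averagingMatrix V)ᴴ = averagingMatrix V := by
    ext u v; simp [averagingMatrix]
  rw [e, averagingMatrix_mul_self] at h
  by_contra! hcon
  nlinarith

variable {E : Matrix V V ℝ} {δ : ℝ}

theorem norm_averagingMatrix_add_le (hE : ‖E‖ ≤ δ) (hδ : δ ≤ 1) : ‖averagingMatrix V + E‖ ≤ 2 :=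
  (norm_add_le _ _).trans (by linarith [norm_averagingMatrix_le (V := V)])

theorem norm_averagingMatrix_add_pow_sub_le (hE : ‖E‖ ≤ δ) (hδ : δ ≤ 1) (k : ℕ) :
    ‖(averagingMatrix V + E) ^ k - averagingMatrix V ^ k‖ ≤ k * 2 ^ k * δ := by
  have hδ0 : 0 ≤ δ := (norm_nonneg _).trans hE
  set P := averagingMatrix V
  induction k with
  | zero => simp
  | succ k ih =>
    have e : (P + E) ^ (k + 1) - P ^ (k + 1) = (P + E) * ((P + E) ^ k - P ^ k) + E * P ^ k := by
      rw [pow_succ', pow_succ']; noncomm_ring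
    rw [e]
    have hPk : ‖P ^ k‖ ≤ 1 := (norm_pow_le P k).trans (pow_le_one₀ (norm_nonneg _) norm_averagingMatrix_le)
    have h2 : (1 : ℝ) ≤ 2 ^ (k + 1) := one_le_pow₀ (by norm_num)
    calc _ ≤ ‖P + E‖ * ‖(P + E) ^ k - P ^ k‖ + ‖E‖ * ‖P ^ k‖ :=
          (norm_add_le _ _).trans (add_le_add (norm_mul_le _ _) (norm_mul_le _ _))
      _ ≤ 2 * (k * 2 ^ k * δ) + δ * 1 := by
          gcongr
          exact norm_averagingMatrix_add_le hE hδ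
      _ ≤ _ := by push_cast; rw [pow_succ] at *; nlinarith

/-- Expand one factor `P + E` at a time. A term containing `P` has trace bounded by an operator
norm; only the final pure power of `E` costs a factor `|V|`, and by then it carries the full
exponent of `δ`. -/
theorem abs_trace_averagingMatrix_add_pow_mul_le (hE : ‖E‖ ≤ δ) (hδ : δ ≤ 1) (k j : ℕ) :
    |((averagingMatrix V + E) ^ k * E ^ (j + 1)).trace| ≤
      k * 2 ^ k * δ + Fintype.card V * δ ^ (k + j + 1) := by
  have hδ0 : 0 ≤ δ := (norm_nonneg _).trans hE
  have hpow : ∀ m : ℕ, ‖E ^ (m + 1)‖ ≤ δ ^ (m + 1) := fun m =>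
    (norm_pow_le E (m + 1)).trans (pow_le_pow_left₀ (norm_nonneg _) hE _)
  set P := averagingMatrix V with hP
  induction k generalizing j with
  | zero =>
    have := abs_trace_le_card_mul_norm (E ^ (j + 1))
    simp only [pow_zero, Matrix.one_mul, Nat.cast_zero, zero_mul, zero_add]
    exact this.trans (by gcongr; exact hpow j)
  | succ k ih =>
    have e : ((P + E) ^ (k + 1) * E ^ (j + 1)).trace =
        (P * (E ^ (j + 1) * (P + E) ^ k)).trace + ((P + E) ^ k * E ^ (j + 1 + 1)).trace := by
      rw [pow_succ, Matrix.mul_assoc, Matrix.add_mul, Matrix.mul_add, Matrix.trace_add,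
        Matrix.trace_mul_comm, Matrix.mul_assoc, pow_succ' E (j + 1)]
    rw [e]
    have h1 : ‖E ^ (j + 1) * (P + E) ^ k‖ ≤ δ * 2 ^ k := by
      refine (norm_mul_le _ _).trans ?_
      have a1 : ‖E ^ (j + 1)‖ ≤ δ := (hpow j).trans (pow_le_of_le_one hδ0 hδ (by omega))
      have a2 : ‖(P + E) ^ k‖ ≤ 2 ^ k := (norm_pow_le _ k).trans
        (pow_le_pow_left₀ (norm_nonneg _) (norm_averagingMatrix_add_le hE hδ) k)
      gcongr
    have h2 := (abs_trace_averagingMatrix_mul_le (E ^ (j + 1) * (P + E) ^ k)).trans h1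
    have h3 := ih (j + 1)
    rw [show k + (j + 1) + 1 = k + 1 + j + 1 by omega] at h3
    have h4 : 0 ≤ (k : ℝ) * 2 ^ k * δ := by positivity
    have h5 : 0 ≤ δ * 2 ^ k := by positivity
    refine (abs_add_le _ _).trans ?_
    push_cast
    rw [pow_succ (2 : ℝ) k]
    linarith

theorem abs_trace_averagingMatrix_add_pow_sub_one_le (hE : ‖E‖ ≤ δ) (hδ : δ ≤ 1) (k : ℕ) :
    |((averagingMatrix V + E) ^ (k + 1)).trace - 1| ≤
      2 * (k * 2 ^ k) * δ + Fintype.card V * δ ^ (k + 1) := by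
  set P := averagingMatrix V with hP
  have h1 := abs_trace_averagingMatrix_add_pow_mul_le hE hδ k 0
  have h2 := (abs_trace_averagingMatrix_mul_le ((P + E) ^ k - P ^ k)).trans
    (norm_averagingMatrix_add_pow_sub_le hE hδ k)
  rw [Matrix.mul_sub, ← hP, averagingMatrix_pow_mul, Matrix.trace_sub, trace_averagingMatrix] at h2
  have e : ((P + E) ^ (k + 1)).trace = (P * (P + E) ^ k).trace + ((P + E) ^ k * E ^ (0 + 1)).trace := by
    rw [pow_succ, Matrix.mul_add, Matrix.trace_add, Matrix.trace_mul_comm, zero_add, pow_one]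
  rw [e]
  have h3 := abs_add_le ((P * (P + E) ^ k).trace - 1) ((P + E) ^ k * E ^ (0 + 1)).trace
  rw [show (P * (P + E) ^ k).trace - 1 + ((P + E) ^ k * E ^ (0 + 1)).trace =
    (P * (P + E) ^ k).trace + ((P + E) ^ k * E ^ (0 + 1)).trace - 1 by ring] at h3
  simp only [add_zero] at h1
  linarith

/-- A principal submatrix is a compression `R S Rᴴ` with `R Rᴴ = 1`. -/
theorem norm_submatrix_le {W : Type*} [Fintype W] [DecidableEq W] (S : Matrix W W ℝ) (e : V ↪ W) :
    ‖S.submatrix e e‖ ≤ ‖S‖ := by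
  set R : Matrix V W ℝ := (1 : Matrix W W ℝ).submatrix e id with hR
  have hRR : R * Rᴴ = 1 := by
    ext u v
    simp [R, Matrix.mul_apply, Matrix.one_apply]
  have hS : S.submatrix e e = R * S * Rᴴ := by
    ext u v
    simp [R, Matrix.mul_apply, Matrix.one_apply]
  have hRn : ‖Rᴴ‖ ≤ 1 := by
    have h := l2_opNorm_conjTranspose_mul_self Rᴴ
    rw [conjTranspose_conjTranspose, hRR] at h
    have h1 : ‖(1 : Matrix V V ℝ)‖ ≤ 1 := by
      rw [← Matrix.diagonal_one, l2_opNorm_diagonal]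
      exact (pi_norm_le_iff_of_nonneg zero_le_one).2 fun _ => by simp
    by_contra! hcon
    nlinarith
  have hRn' : ‖R‖ ≤ 1 := by rw [← l2_opNorm_conjTranspose]; exact hRn
  rw [hS]
  calc ‖R * S * Rᴴ‖ ≤ ‖R‖ * ‖S‖ * ‖Rᴴ‖ := (l2_opNorm_mul _ _).trans
        (by gcongr; exact l2_opNorm_mul _ _)
    _ ≤ 1 * ‖S‖ * 1 := by gcongr
    _ = ‖S‖ := by ring

theorem norm_skewHadamard_le {S : Matrix V V ℝ} (hT : Sᵀ = -S) {c : ℝ} (hc : 0 ≤ c)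
    (hS : S * S = (-c) • 1) : ‖S‖ ≤ √c := by
  have h := l2_opNorm_conjTranspose_mul_self S
  rw [conjTranspose_eq_transpose_of_trivial, hT, Matrix.neg_mul, hS, ← neg_smul, neg_neg,
    norm_smul, Real.norm_of_nonneg hc, CStarRing.norm_one, mul_one] at h
  exact Real.le_sqrt_of_sq_le (by rw [sq, h])

end TraceEstimates

/-! ### Tournaments with asymptotically random cycle densities -/

section Quasirandom

open Matrix Filter Topology
open scoped Matrix.Norms.L2Operator

/-- Arcs are the `+1` entries of an `n × n` principal submatrix of a skew Hadamard core whose order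
is a power of two and at most `2n`; its norm is at most `√(2n)`, and `E` is this submatrix divided
by `n`. -/
theorem exists_tournament_small_spectrum (n : ℕ) (hn : 0 < n) : ∃ T : Digraph (Fin n),
    IsTournament T ∧ ∃ E : Matrix (Fin n) (Fin n) ℝ, ‖E‖ ≤ √(2 / n) ∧
      T.normalizedMatrix = averagingMatrix (Fin n) + E := by
  have : Nonempty (Fin n) := ⟨⟨0, hn⟩⟩
  have hle : n ≤ 2 ^ Nat.clog 2 n := Nat.le_pow_clog (by norm_num) n
  have hlt : (2 : ℝ) ^ Nat.clog 2 n ≤ 2 * n := by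
    rcases Nat.lt_or_ge 1 n with h1 | h1
    · have h2 := Nat.pow_pred_clog_lt_self (b := 2) (by norm_num) h1
      have h3 : 0 < Nat.clog 2 n := Nat.clog_pos (by norm_num) h1
      obtain ⟨m, hm⟩ : ∃ m, Nat.clog 2 n = m + 1 := ⟨Nat.clog 2 n - 1, by omega⟩
      rw [hm] at h2 ⊢
      simp only [Nat.pred_succ] at h2
      have h4 : 2 ^ (m + 1) ≤ 2 * n := by rw [pow_succ]; omega
      exact_mod_cast h4
    · have : n = 1 := by omega
      subst this
      simp
  obtain ⟨S, hT, hS, hSS⟩ := exists_skewHadamard (Nat.clog 2 n)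
  let e : Fin n ↪ Fin (2 ^ Nat.clog 2 n) := Fin.castLEEmb hle
  have hd := diag_eq_zero_of_transpose_eq_neg hT
  have hanti : ∀ u v, S v u = -S u v := fun u v => congrFun (congrFun hT u) v
  refine ⟨⟨fun u v => S (e u) (e v) = 1⟩, ⟨fun v => ?_, fun u v huv => ?_⟩,
    (n : ℝ)⁻¹ • S.submatrix e e, ?_, ?_⟩
  · simp [hd]
  · have hne : e u ≠ e v := fun h => huv (e.injective h)
    rcases hS _ _ hne with h | h
    · left; refine ⟨h, ?_⟩
      simp only [hanti (e u) (e v), h]; norm_num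
    · right; refine ⟨?_, ?_⟩
      · simp only [hanti (e u) (e v), h]; norm_num
      · simp only [h]; norm_num
  · have hn' : (0 : ℝ) < n := by exact_mod_cast hn
    have h1 : (1 : ℝ) ≤ 2 ^ Nat.clog 2 n := one_le_pow₀ (by norm_num)
    have h2 := (norm_submatrix_le S e).trans
      (norm_skewHadamard_le hT (by linarith) hSS)
    rw [norm_smul, norm_inv, Real.norm_of_nonneg hn'.le]
    refine (mul_le_mul_of_nonneg_left h2 (by positivity)).trans ?_
    refine Real.le_sqrt_of_sq_le ?_
    rw [mul_pow, Real.sq_sqrt (by linarith)]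
    rw [inv_pow, inv_mul_le_iff₀ (by positivity)]
    have : (n : ℝ) ^ 2 * (2 / n) = 2 * n := by field_simp
    linarith
  · have hn' : (n : ℝ) ≠ 0 := by exact_mod_cast hn.ne'
    ext u v
    simp only [Digraph.normalizedMatrix, Digraph.halfLoopMatrix, Digraph.realAdjMatrix,
      averagingMatrix, Matrix.add_apply, Matrix.smul_apply, Matrix.of_apply, smul_eq_mul,
      Fintype.card_fin, Matrix.submatrix_apply]
    by_cases huv : u = v
    · subst huv
      simp only [hd, Matrix.one_apply_eq]
      norm_num
    · rw [Matrix.one_apply_ne huv]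
      have hne : e u ≠ e v := fun h => huv (e.injective h)
      rcases hS _ _ hne with h | h
      · simp only [h]; norm_num; field_simp; norm_num
      · simp only [h]; norm_num

theorem exists_quasirandom_tournaments : ∃ T : ∀ n : ℕ, Digraph (Fin n), (∀ n, IsTournament (T n)) ∧
    ∀ k : ℕ, 3 ≤ k → Tendsto (fun n => cycleDensity k (T n)) atTop (𝓝 (1 / 2 ^ k)) := by
  have hex : ∀ n : ℕ, ∃ T : Digraph (Fin n), IsTournament T ∧ (0 < n →
      ∃ E : Matrix (Fin n) (Fin n) ℝ, ‖E‖ ≤ √(2 / n) ∧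
        T.normalizedMatrix = averagingMatrix (Fin n) + E) := by
    intro n
    rcases Nat.eq_zero_or_pos n with rfl | hn
    · exact ⟨⟨fun _ _ => False⟩, ⟨fun v => v.elim0, fun v => v.elim0⟩, fun h => absurd h (lt_irrefl 0)⟩
    · obtain ⟨T, hT, h⟩ := exists_tournament_small_spectrum n hn
      exact ⟨T, hT, fun _ => h⟩
  choose T hT hE using hex
  refine ⟨T, hT, fun k hk => ?_⟩
  obtain ⟨m, rfl⟩ : ∃ m, k = m + 2 + 1 := ⟨k - 3, by omega⟩
  have hδ : Tendsto (fun n : ℕ => √(2 / n)) atTop (𝓝 0) := by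
    have := (tendsto_const_div_atTop_nhds_zero_nat (2 : ℝ)).sqrt
    simpa using this
  have htr : Tendsto (fun n => ((T n).normalizedMatrix ^ (m + 2 + 1)).trace) atTop (𝓝 1) := by
    have hb : Tendsto (fun n : ℕ => (2 * ((m + 2 : ℕ) * 2 ^ (m + 2)) + 2) * √(2 / n)) atTop (𝓝 0) := by
      simpa using hδ.const_mul (2 * ((m + 2 : ℕ) * 2 ^ (m + 2)) + 2 : ℝ)
    rw [tendsto_iff_norm_sub_tendsto_zero]
    refine squeeze_zero' (Eventually.of_forall fun _ => norm_nonneg _) ?_ hb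
    filter_upwards [eventually_ge_atTop 2] with n hn
    have : Nonempty (Fin n) := ⟨⟨0, by omega⟩⟩
    obtain ⟨E, hEn, hTE⟩ := hE n (by omega)
    have hn' : (2 : ℝ) ≤ n := by exact_mod_cast hn
    have hδ1 : √(2 / (n : ℝ)) ≤ 1 := Real.sqrt_le_one.2 (by
      rw [div_le_one (by linarith)]; exact hn')
    have hmain := abs_trace_averagingMatrix_add_pow_sub_one_le hEn hδ1 (m + 2)
    rw [hTE, Real.norm_eq_abs]
    refine hmain.trans ?_
    set δ := √(2 / (n : ℝ)) with hδdef
    have hδ0 : 0 ≤ δ := Real.sqrt_nonneg _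
    have hsq : (n : ℝ) * δ ^ 2 = 2 := by
      rw [hδdef, Real.sq_sqrt (by positivity)]
      field_simp
    -- Since `nδ² = 2`, the term `nδ^k` tends to zero exactly when `k ≥ 3`.
    have hlast : (Fintype.card (Fin n) : ℝ) * δ ^ (m + 2 + 1) ≤ 2 * δ := by
      rw [Fintype.card_fin]
      calc (n : ℝ) * δ ^ (m + 2 + 1) = (n * δ ^ 2) * δ * δ ^ m := by ring
        _ = 2 * δ * δ ^ m := by rw [hsq]
        _ ≤ 2 * δ * 1 := by gcongr; exact pow_le_one₀ hδ0 hδ1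
        _ = _ := by ring
    rw [add_mul]
    linarith
  have hup : Tendsto (fun n => ((T n).normalizedMatrix ^ (m + 2 + 1)).trace / 2 ^ (m + 2 + 1)) atTop
      (𝓝 (1 / 2 ^ (m + 2 + 1))) := htr.div_const _
  have hlo : Tendsto (fun n : ℕ => ((T n).normalizedMatrix ^ (m + 2 + 1)).trace / 2 ^ (m + 2 + 1) -
      ((m + 2 + 1 : ℕ) / 2 : ℝ) / n) atTop (𝓝 (1 / 2 ^ (m + 2 + 1))) := by
    simpa using hup.sub (tendsto_const_div_atTop_nhds_zero_nat (((m + 2 + 1 : ℕ) / 2 : ℝ)))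
  refine tendsto_of_tendsto_of_tendsto_of_le_of_le' hlo hup ?_ ?_
  · filter_upwards [eventually_ge_atTop 1] with n hn
    have : Nonempty (Fin n) := ⟨⟨0, by omega⟩⟩
    have := (hT n).trace_le_cycleDensity (k := m + 2 + 1) (by omega)
    rw [Fintype.card_fin] at this
    rw [sub_le_iff_le_add, div_le_iff₀ (by positivity)]
    linarith
  · refine Eventually.of_forall fun n => ?_
    have := (T n).cycleDensity_le_trace (k := m + 2 + 1) (by omega)
    change _ ≤ _ / _
    rw [le_div_iff₀ (by positivity)]
    linarith

end Quasirandom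

/-! ### The two-part construction -/

section OrderedSum

open Matrix

theorem fromBlocks_zero_pow {V W : Type*} [Fintype V] [DecidableEq V] [Fintype W] [DecidableEq W]
    (A : Matrix V V ℝ) (B : Matrix V W ℝ) (D : Matrix W W ℝ) (k : ℕ) :
    ∃ B', fromBlocks A B 0 D ^ k = fromBlocks (A ^ k) B' 0 (D ^ k) := by
  induction k with
  | zero => exact ⟨0, by simp [fromBlocks_one]⟩
  | succ k ih =>
    obtain ⟨B', h⟩ := ih
    refine ⟨A ^ k * B + B' * D, ?_⟩
    rw [pow_succ, h, fromBlocks_multiply]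
    simp [pow_succ]

/-- The disjoint union of two digraphs with all arcs from the first to the second. -/
def Digraph.orderedSum {V W : Type*} (T : Digraph V) (U : Digraph W) : Digraph (V ⊕ W) where
  Adj := Sum.Lex T.Adj U.Adj

theorem IsTournament.orderedSum {V W : Type*} {T : Digraph V} {U : Digraph W}
    (hT : IsTournament T) (hU : IsTournament U) : IsTournament (T.orderedSum U) where
  loopless := by
    rintro (v | v)
    · simpa [Digraph.orderedSum] using hT.loopless v
    · simpa [Digraph.orderedSum] using hU.loopless v
  oriented := by
    rintro (u | u) (v | v) h
    · simpa [Digraph.orderedSum] using hT.oriented u v (fun e => h (e ▸ rfl))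
    · simp [Digraph.orderedSum]
    · simp [Digraph.orderedSum]
    · simpa [Digraph.orderedSum] using hU.oriented u v (fun e => h (e ▸ rfl))

/-- The adjacency matrix is block triangular: no closed walk uses a cross arc. -/
theorem trace_orderedSum_pow {V W : Type*} [Fintype V] [DecidableEq V] [Fintype W] [DecidableEq W]
    (T : Digraph V) (U : Digraph W) (k : ℕ) :
    ((T.orderedSum U).realAdjMatrix ^ k).trace =
      (T.realAdjMatrix ^ k).trace + (U.realAdjMatrix ^ k).trace := by
  have h : (T.orderedSum U).realAdjMatrix =
      fromBlocks T.realAdjMatrix (Matrix.of fun _ _ => 1) 0 U.realAdjMatrix := by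
    classical
    ext (u | u) (v | v)
    · exact if_congr Sum.lex_inl_inl rfl rfl
    · simp [Digraph.realAdjMatrix, Digraph.orderedSum]
    · simp [Digraph.realAdjMatrix, Digraph.orderedSum]
    · exact if_congr Sum.lex_inr_inr rfl rfl
  obtain ⟨B', hB⟩ := fromBlocks_zero_pow T.realAdjMatrix (Matrix.of fun _ _ => 1) U.realAdjMatrix k
  rw [h, hB]
  simp [Matrix.trace]

theorem exists_orderedSum_fin {a b n : ℕ} (hab : a + b = n) (ha : 0 < a) (hb : 0 < b)
    {T : Digraph (Fin a)} {U : Digraph (Fin b)} (hT : IsTournament T) (hU : IsTournament U) :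
    ∃ X : Digraph (Fin n), IsTournament X ∧ ∀ k, 0 < k → cycleDensity k X =
      ((a : ℝ) / n) ^ k * cycleDensity k T + ((b : ℝ) / n) ^ k * cycleDensity k U := by
  let e : Fin n ≃ Fin a ⊕ Fin b := (finSumFinEquiv.trans (finCongr hab)).symm
  have hX := hT.orderedSum hU
  refine ⟨⟨fun u v => (T.orderedSum U).Adj (e u) (e v)⟩, ⟨fun v => hX.loopless _, fun u v h =>
    hX.oriented _ _ fun h' => h (e.injective h')⟩, fun k hk => ?_⟩
  have hM : (⟨fun u v => (T.orderedSum U).Adj (e u) (e v)⟩ : Digraph (Fin n)).realAdjMatrix =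
      (T.orderedSum U).realAdjMatrix.submatrix e e := rfl
  have hpow : ∀ k : ℕ, ((T.orderedSum U).realAdjMatrix.submatrix e e) ^ k =
      ((T.orderedSum U).realAdjMatrix ^ k).submatrix e e := by
    intro k
    induction k with
    | zero => simp
    | succ k ih => rw [pow_succ, ih, submatrix_mul_equiv, ← pow_succ]
  have htr : ∀ Y : Matrix (Fin a ⊕ Fin b) (Fin a ⊕ Fin b) ℝ, (Y.submatrix e e).trace = Y.trace :=
    fun Y => e.sum_comp fun i => Y i i
  have ha' : (a : ℝ) ≠ 0 := by exact_mod_cast ha.ne'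
  have hb' : (b : ℝ) ≠ 0 := by exact_mod_cast hb.ne'
  have hn' : (n : ℝ) ≠ 0 := by exact_mod_cast (by omega : n ≠ 0)
  rw [cycleDensity_eq_trace _ hk, cycleDensity_eq_trace _ hk, cycleDensity_eq_trace _ hk, hM, hpow,
    htr, trace_orderedSum_pow, Fintype.card_fin, Fintype.card_fin, Fintype.card_fin]
  simp only [div_pow]
  field_simp

end OrderedSum

/-! ### Asymptotic tightness -/

section Tightness

open Filter Topology

theorem exists_tournaments_tendsto {z : ℝ} (hz0 : 0 < z) (hz1 : z < 1) :
    ∃ X : ∀ n : ℕ, Digraph (Fin n), (∀ᶠ n in atTop, IsTournament (X n)) ∧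
      ∀ k : ℕ, 3 ≤ k → Tendsto (fun n => cycleDensity k (X n)) atTop
        (𝓝 (1 / 2 ^ k * (z ^ k + (1 - z) ^ k))) := by
  obtain ⟨Q, hQ, hlim⟩ := exists_quasirandom_tournaments
  let a : ℕ → ℕ := fun n => ⌊z * n⌋₊
  let b : ℕ → ℕ := fun n => n - a n
  have hle : ∀ n, a n ≤ n := fun n => Nat.floor_le_of_le
    (mul_le_of_le_one_left (Nat.cast_nonneg n) hz1.le)
  have ha : Tendsto (fun n : ℕ => (a n : ℝ) / n) atTop (𝓝 z) :=
    (tendsto_nat_floor_mul_div_atTop hz0.le).comp tendsto_natCast_atTop_atTop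
  have hb : Tendsto (fun n : ℕ => (b n : ℝ) / n) atTop (𝓝 (1 - z)) := by
    refine (ha.const_sub 1).congr' ?_
    filter_upwards [eventually_gt_atTop 0] with n hn
    have hn' : (n : ℝ) ≠ 0 := by exact_mod_cast hn.ne'
    simp only [b]
    rw [Nat.cast_sub (hle n)]
    field_simp
  have hainf : Tendsto a atTop atTop :=
    tendsto_nat_floor_atTop.comp (tendsto_natCast_atTop_atTop.const_mul_atTop hz0)
  have hbinf : Tendsto b atTop atTop := by
    have h1 : Tendsto (fun n : ℕ => (b n : ℝ)) atTop atTop := by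
      refine tendsto_atTop_mono (fun n => ?_)
        (tendsto_natCast_atTop_atTop.const_mul_atTop (sub_pos.2 hz1))
      simp only [b]
      rw [Nat.cast_sub (hle n)]
      have := Nat.floor_le (mul_nonneg hz0.le (Nat.cast_nonneg (α := ℝ) n))
      simp only [a]
      linarith
    exact tendsto_natCast_atTop_iff.1 h1
  have hex : ∀ n, ∃ X : Digraph (Fin n), 0 < a n → 0 < b n → IsTournament X ∧ ∀ k, 0 < k →
      cycleDensity k X = ((a n : ℝ) / n) ^ k * cycleDensity k (Q (a n)) +
        ((b n : ℝ) / n) ^ k * cycleDensity k (Q (b n)) := by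
    intro n
    by_cases h : 0 < a n ∧ 0 < b n
    · obtain ⟨X, hX⟩ := exists_orderedSum_fin (Nat.add_sub_cancel' (hle n)) h.1 h.2 (hQ (a n))
        (hQ (b n))
      exact ⟨X, fun _ _ => hX⟩
    · exact ⟨⟨fun _ _ => False⟩, fun h1 h2 => absurd ⟨h1, h2⟩ h⟩
  choose X hX using hex
  have hev : ∀ᶠ n in atTop, 0 < a n ∧ 0 < b n :=
    (hainf.eventually_gt_atTop 0).and (hbinf.eventually_gt_atTop 0)
  refine ⟨X, hev.mono fun n h => (hX n h.1 h.2).1, fun k hk => ?_⟩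
  have h1 : Tendsto (fun n => ((a n : ℝ) / n) ^ k * cycleDensity k (Q (a n)) +
        ((b n : ℝ) / n) ^ k * cycleDensity k (Q (b n))) atTop
      (𝓝 (z ^ k * (1 / 2 ^ k) + (1 - z) ^ k * (1 / 2 ^ k))) :=
    ((ha.pow k).mul ((hlim k hk).comp hainf)).add ((hb.pow k).mul ((hlim k hk).comp hbinf))
  rw [show 1 / 2 ^ k * (z ^ k + (1 - z) ^ k) =
    z ^ k * (1 / 2 ^ k) + (1 - z) ^ k * (1 / 2 ^ k) by ring]
  exact h1.congr' (hev.mono fun n h => ((hX n h.1 h.2).2 k (by omega)).symm)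

theorem blowUpDensity_asymptotically_tight {ℓ : ℕ} (hℓ : 4 ≤ ℓ) {q : ℝ} (hq0 : 0 < q)
    (hq : q ≤ 1 / 160) {s : ℝ} (hs : s ∈ Set.Icc (1 / 8 - q) (1 / 8)) {ε : ℝ} (hε : 0 < ε) :
    ∃ N : ℕ, ∀ n : ℕ, N ≤ n → ∃ T : Digraph (Fin n), IsTournament T ∧
      1 / 8 - q ≤ cycleDensity 3 T ∧ |cycleDensity 3 T - s| ≤ ε ∧
      cycleDensity ℓ T ≤ blowUpDensity ℓ (cycleDensity 3 T) + ε := by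
  obtain ⟨hs0, hs1⟩ := hs
  -- The target is moved slightly towards the midpoint of the interval: `s' > 1/8 - q` lets
  -- convergence to `s'` ensure the density condition eventually, and `s' < 1/8` keeps both parts
  -- nonempty in the limit.
  obtain ⟨s', hs'0, hs'1, hs's⟩ : ∃ s', 1 / 8 - q < s' ∧ s' < 1 / 8 ∧ |s' - s| < ε := by
    have ht0 : 0 < min (1 / 2) (ε / 2) := by positivity
    have ht1 : min (1 / 2) (ε / 2) ≤ 1 / 2 := min_le_left _ _
    have ht2 : min (1 / 2) (ε / 2) ≤ ε / 2 := min_le_right _ _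
    set t := min (1 / 2) (ε / 2)
    refine ⟨s + t * (1 / 8 - q / 2 - s), by nlinarith, by nlinarith, ?_⟩
    rw [add_sub_cancel_left, abs_lt]
    constructor <;> nlinarith
  obtain ⟨hz0, hz1, hz⟩ := splitPoint_spec (s := s') (by linarith) hs'1.le
  have hz1' : splitPoint s' < 1 := by
    refine lt_of_le_of_ne hz1 fun h => ?_
    rw [h] at hz
    linarith
  obtain ⟨X, hX, hlim⟩ := exists_tournaments_tendsto (by linarith) hz1'
  have h3 : Tendsto (fun n => cycleDensity 3 (X n)) atTop (𝓝 s') := by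
    have := hlim 3 le_rfl
    rwa [show 1 / 2 ^ 3 * (splitPoint s' ^ 3 + (1 - splitPoint s') ^ 3) = s' by
      linarith [show splitPoint s' ^ 3 + (1 - splitPoint s') ^ 3 =
        1 - 3 * (splitPoint s' * (1 - splitPoint s')) by ring]] at this
  -- A continuous formula agreeing with the extremal function near `1/8`; it transfers the limit at
  -- `s'` to the actual triangle densities.
  let G : ℝ → ℝ := fun s => 1 / 2 ^ ℓ * (splitPoint s ^ ℓ + (1 - splitPoint s) ^ ℓ)
  have hG : Continuous G := by
    have := continuous_splitPoint
    fun_prop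
  have hdiff : Tendsto (fun n => cycleDensity ℓ (X n) - G (cycleDensity 3 (X n))) atTop (𝓝 0) := by
    have := (hlim ℓ (by omega)).sub ((hG.tendsto s').comp h3)
    rwa [show 1 / 2 ^ ℓ * (splitPoint s' ^ ℓ + (1 - splitPoint s') ^ ℓ) - G s' = 0 from
      sub_self _] at this
  have habs : Tendsto (fun n => |cycleDensity 3 (X n) - s|) atTop (𝓝 |s' - s|) :=
    (h3.sub_const s).abs
  have hev := hX.and ((h3.eventually (lt_mem_nhds hs'0)).and
    ((habs.eventually (gt_mem_nhds hs's)).and ((hdiff.eventually (gt_mem_nhds hε)).and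
      (eventually_gt_atTop 0))))
  obtain ⟨N, hN⟩ := eventually_atTop.1 hev
  refine ⟨N, fun n hn => ?_⟩
  obtain ⟨hT, h1, h2, h4, hpos⟩ := hN n hn
  have : Nonempty (Fin n) := ⟨⟨0, hpos⟩⟩
  refine ⟨X n, hT, h1.le, h2.le, ?_⟩
  rw [blowUpDensity_eq_splitPoint ℓ (by linarith) hT.cycleDensity_three_le]
  change _ ≤ G _ + ε
  linarith

end Tightness

theorem theorem2 (ℓ : ℕ) (hℓ : 4 ≤ ℓ) (hmod : ¬ ℓ ≡ 2 [MOD 4]) :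
    -- the lower bound
    (∀ ε : ℝ, 0 < ε → ∃ N : ℕ, ∀ (V : Type*) [Fintype V] (T : Digraph V), IsTournament T →
      N ≤ Fintype.card V →
      1 / 8 - 1 / (10 * (ℓ : ℝ) ^ 2) ≤ cycleDensity 3 T →
      blowUpDensity ℓ (cycleDensity 3 T) - ε ≤ cycleDensity ℓ T) ∧
    -- its asymptotic tightness at every possible density of 3-cycles in the range
    (∀ s ∈ Set.Icc (1 / 8 - 1 / (10 * (ℓ : ℝ) ^ 2)) (1 / 8), ∀ ε : ℝ, 0 < ε →
      ∃ N : ℕ, ∀ n : ℕ, N ≤ n → ∃ T : Digraph (Fin n), IsTournament T ∧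
        1 / 8 - 1 / (10 * (ℓ : ℝ) ^ 2) ≤ cycleDensity 3 T ∧
        |cycleDensity 3 T - s| ≤ ε ∧
        cycleDensity ℓ T ≤ blowUpDensity ℓ (cycleDensity 3 T) + ε) := by
  have hL : (4 : ℝ) ≤ ℓ := by exact_mod_cast hℓ
  have hL2 : (16 : ℝ) ≤ (ℓ : ℝ) ^ 2 := by nlinarith
  refine ⟨fun ε hε => ?_, fun s hs ε hε => ?_⟩
  -- The error `ℓ/(2n)` is at most `ε` from here on; the `+ 1` excludes the empty tournament.
  · refine ⟨⌈(ℓ : ℝ) / 2 / ε⌉₊ + 1, fun V _ T hT hN h => ?_⟩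
    have : Nonempty V := Fintype.card_pos_iff.1 (by omega)
    have hmain := hT.blowUpDensity_le hℓ hmod h
    have hn : (0 : ℝ) < Fintype.card V := by exact_mod_cast Fintype.card_pos
    have hle : (ℓ : ℝ) / 2 / ε ≤ Fintype.card V :=
      (Nat.le_ceil _).trans (by exact_mod_cast (by omega : ⌈(ℓ : ℝ) / 2 / ε⌉₊ ≤ Fintype.card V))
    have herr : (ℓ : ℝ) / 2 / Fintype.card V ≤ ε := by
      rw [div_le_iff₀ hε] at hle
      rw [div_le_iff₀ hn]
      linarith
    linarith
  · exact blowUpDensity_asymptotically_tight hℓ (by positivity)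
      (one_div_le_one_div_of_le (by norm_num) (by linarith)) hs hε
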